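/- Let $d\in\mathbb N$, $\Omega=(0,1)^d$, $N\in\mathbb N$, and let $\psi_0,\psi_1\in C^N(\mathbb R)$ be compactly supported with $\int x^k\psi_1(x)\,dx=0$ for $k=0,\dots,N$, such that, with $\psi_{0,m}(x)=\psi_0(x-m)$ and $\psi_{j,m}(x)=\sqrt{1/2}\,\psi_1(2^{j-1}x-m)$ for $j\ge1$, the system $\{2^{j/2}\psi_{j,m}:j\in\mathbb N_0,m\in\mathbb Z\}$ is an orthonormal basis of $L_2(\mathbb R)$. For $\nu\in\mathbb N_0^d$, $m\in\mathbb Z^d$ put $\Psi_{\nu,m}(x)=\prod_{\ell=1}^d\psi_{\nu_\ell,m_\ell}(x_\ell)$, $|\nu|_1=\nu_1+\dots+\nu_d$, $A_\nu^\Omega=\{m\in\mathbb Z^d:\operatorname{supp}\Psi_{\nu,m}\cap\Omega\ne\emptyset\}$, and let $\chi_{\nu,m}$ be the characteristic function of $\{x\in\mathbb R^d:2^{-\nu_\ell}m_\ell<x_\ell<2^{-\nu_\ell}(m_\ell+1),\ \ell=1,\dots,d\}$. For families $\lambda=(\lambda_{\nu,m})_{\nu\in\mathbb N_0^d,\,m\in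 A_\nu^\Omega}$ of complex numbers let $$\|\lambda|s^{t,\Omega}_{p_1,p_1}b\|=\Big(\sum_{\nu}2^{|\nu|_1(t-\frac1{p_1})p_1}\sum_{m\in A_\nu^\Omega}|\lambda_{\nu,m}|^{p_1}\Big)^{1/p_1}$$ (with the supremum of $2^{|\nu|_1t}|\lambda_{\nu,m}|$ if $p_1=\infty$) and $$\|\lambda|s^{0,\Omega}_{p_2,2}f\|=\Big\|\Big(\sum_{\nu}\sum_{m\in A_\nu^\Omega}|\lambda_{\nu,m}\chi_{\nu,m}(\cdot)|^2\Big)^{1/2}\Big|L_{p_2}(\mathbb R^d)\Big\|.$$ Let $X=s^{0,\Omega}_{p_2,2}f$ be the space of all $\lambda$ for which the second expression is finite, and let $K=\{\lambda:\|\lambda|s^{t,\Omega}_{p_1,p_1}b\|\le1\}$. A complex $\mathscr C$ in a real vector space is the union of finitely many simplices $\operatorname{conv}T$, $T\in\mathcal T$, where $\mathcal T$ is a finite collection of finite sets of points in general position (affinely independent) which is closed under passing to subsets (including the empty set) and such that any two of these simplices intersect in $\operatorname{conv}T$ for some $T\in\mathcal T$; $\dim\mathscr C=\max_{T\in\mathcal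 T}(|T|-1)$. With $K$ carrying the topology of $X$, define the Alexandroff width, the co-width and the manifold width by $$a_n(K,X)=\inf_{\mathscr C,F}\sup_{x\in K}\|x-F(x)|X\|,\qquad a^n(K|X)=\inf_{\mathscr C,G}\sup_{x\in K}\operatorname{diam}_X G^{-1}(G(x)),\qquad \delta_n(K,X)=\inf_{a,M}\sup_{x\in K}\|x-M(a(x))|X\|,$$ where the infima are taken over all $n$-dimensional complexes $\mathscr C$ in $X$ and continuous $F:K\to\mathscr C$; over all $n$-dimensional complexes $\mathscr C$ in arbitrary normed spaces and continuous $G:K\to\mathscr C$; and over all continuous $a:K\to\mathbb R^n$ and $M:\mathbb R^n\to X$, respectively. Theorem. Let $0<p_1\le\infty$, $0<p_2<\infty$ and $t>\big(\frac1{p_1}-\frac1{\max(p_2,2)}\big)_+$. Then there is a constant $c>0$, independent of $n$, such that for all $n\ge2$ each of $a_n(K,X)$, $a^n(K|X)$, $\delta_n(K,X)$ is at most $$c\,n^{-t}(\log n)^{(d-1)(t-\frac1{p_1}+\frac12)}.$$ -/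

import Mathlib

open MeasureTheory Set
open scoped ENNReal

noncomputable section

/-! Complexes in real vector spaces -/

/-- A finite complex in a real vector space `E`, given by the vertex sets of its simplices: every
vertex set is in general position, subsets of vertex sets are vertex sets (the empty one included,
so that disjoint simplices are allowed), and two simplices meet in a simplex of the complex. -/
structure SimplexComplex (E : Type*) [AddCommGroup E] [Module ℝ E] where
  faces : Set (Finset E)
  finite_faces : faces.Finite
  indep : ∀ s ∈ faces, AffineIndependent ℝ (fun v : s => (v : E))
  down_closed : ∀ s ∈ faces, ∀ s' ⊆ s, s' ∈ faces
  inter : ∀ s₁ ∈ faces, ∀ s₂ ∈ faces, ∃ s ∈ faces,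
    convexHull ℝ (s₁ : Set E) ∩ convexHull ℝ (s₂ : Set E) = convexHull ℝ (s : Set E)

/-- The union of the simplices. -/
def SimplexComplex.carrier {E : Type*} [AddCommGroup E] [Module ℝ E] (C : SimplexComplex E) :
    Set E :=
  ⋃ s ∈ C.faces, convexHull ℝ (s : Set E)

/-- The dimension, `max (|s| - 1)` over all vertex sets `s`, equals `n`. -/
def SimplexComplex.HasDim {E : Type*} [AddCommGroup E] [Module ℝ E] (C : SimplexComplex E)
    (n : ℕ) : Prop :=
  (∀ s ∈ C.faces, s.card ≤ n + 1) ∧ ∃ s ∈ C.faces, s.card = n + 1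

/-! Nonlinear widths. The (quasi-)normed space `X` is given by a vector space `E` together with an
extended (quasi-)norm `N : E → [0, ∞]`; it consists of the `x` with `N x < ∞`. -/

/-- Continuity on `K` with respect to the (quasi-)norms `N` and `N'`. -/
def GaugeContinuousOn {E E' : Type*} [AddCommGroup E] [AddCommGroup E']
    (N : E → ℝ≥0∞) (N' : E' → ℝ≥0∞) (f : E → E') (K : Set E) : Prop :=
  ∀ x ∈ K, ∀ ε > 0, ∃ δ > 0, ∀ y ∈ K, N (y - x) < δ → N' (f y - f x) < ε

/-- The diameter of `S` with respect to `N`. -/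
def gaugeDiam {E : Type*} [AddCommGroup E] (N : E → ℝ≥0∞) (S : Set E) : ℝ≥0∞ :=
  ⨆ x ∈ S, ⨆ y ∈ S, N (x - y)

/-- The Alexandroff `n`-width of `K` in `X`: the infimum over all `n`-dimensional complexes `C`
in `X` and all continuous `F : K → C` of the largest distance between `x ∈ K` and `F x`. -/
def alexandroffWidth {E : Type*} [AddCommGroup E] [Module ℝ E] (N : E → ℝ≥0∞) (K : Set E)
    (n : ℕ) : ℝ≥0∞ :=
  ⨅ (C : SimplexComplex E) (_ : C.HasDim n) (_ : ∀ s ∈ C.faces, ∀ v ∈ s, N v < ∞)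
    (F : E → E) (_ : GaugeContinuousOn N N F K) (_ : MapsTo F K C.carrier),
    ⨆ x ∈ K, N (x - F x)

/-- The `n`-co-width of `K`: the infimum over all `n`-dimensional complexes `C` in arbitrary normed
spaces and all continuous `G : K → C` of the largest diameter of a fibre of `G`. A complex
lies in a finite-dimensional space, so it suffices to take normed spaces in `Type`. -/
def coWidth {E : Type*} [AddCommGroup E] (N : E → ℝ≥0∞) (K : Set E) (n : ℕ) : ℝ≥0∞ :=
  ⨅ (V : Type) (_ : NormedAddCommGroup V) (_ : NormedSpace ℝ V)
    (C : SimplexComplex V) (_ : C.HasDim n)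
    (G : E → V) (_ : GaugeContinuousOn N (fun v : V => ‖v‖ₑ) G K) (_ : MapsTo G K C.carrier),
    ⨆ x ∈ K, gaugeDiam N {y ∈ K | G y = G x}

/-- The manifold `n`-width of `K` in `X`: the infimum over all continuous `a : K → ℝⁿ` and
`M : ℝⁿ → X` of the largest distance between `x ∈ K` and `M (a x)`. -/
def manifoldWidth {E : Type*} [AddCommGroup E] (N : E → ℝ≥0∞) (K : Set E) (n : ℕ) : ℝ≥0∞ :=
  ⨅ (a : E → EuclideanSpace ℝ (Fin n)) (_ : GaugeContinuousOn N (fun v => ‖v‖ₑ) a K)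
    (M : EuclideanSpace ℝ (Fin n) → E) (_ : ∀ y, N (M y) < ∞)
    (_ : GaugeContinuousOn (fun v => ‖v‖ₑ) N M univ),
    ⨆ x ∈ K, N (x - M (a x))

/-! Compactly supported wavelets -/

/-- `ψ_{j,m}`: `ψ₀ (x - m)` for `j = 0` and `√(1/2) ψ₁ (2^(j-1) x - m)` for `j ≥ 1`. -/
def waveletFn (ψ₀ ψ₁ : ℝ → ℂ) : ℕ → ℤ → ℝ → ℂ
  | 0, m, x => ψ₀ (x - m)
  | j + 1, m, x => (Real.sqrt (1 / 2) : ℂ) * ψ₁ (2 ^ j * x - m)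

/-- `ψ₀, ψ₁` are compactly supported of class `C^N`, the moments of `ψ₁` up to order `N` vanish,
and `2^(j/2) ψ_{j,m}`, `j ∈ ℕ₀`, `m ∈ ℤ`, is an orthonormal basis of `L₂(ℝ)`. -/
structure IsWaveletSystem (N : ℕ) (ψ₀ ψ₁ : ℝ → ℂ) : Prop where
  contDiff_zero : ContDiff ℝ N ψ₀
  contDiff_one : ContDiff ℝ N ψ₁
  compact_zero : HasCompactSupport ψ₀
  compact_one : HasCompactSupport ψ₁
  moments : ∀ k : ℕ, k ≤ N → ∫ x : ℝ, (x : ℂ) ^ k * ψ₁ x = 0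
  basis : ∃ b : HilbertBasis (ℕ × ℤ) ℂ (Lp ℂ 2 (volume : Measure ℝ)), ∀ i : ℕ × ℤ,
    (b i : ℝ → ℂ) =ᵐ[volume]
      fun x => (((2 : ℝ) ^ ((i.1 : ℝ) / 2) : ℝ) : ℂ) * waveletFn ψ₀ ψ₁ i.1 i.2 x

/-- The tensor product wavelet `Ψ_{ν,m}` on `ℝ^d`. -/
def tensorWavelet {d : ℕ} (ψ₀ ψ₁ : ℝ → ℂ) (ν : Fin d → ℕ) (m : Fin d → ℤ)
    (x : Fin d → ℝ) : ℂ :=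
  ∏ l, waveletFn ψ₀ ψ₁ (ν l) (m l) (x l)

/-- The index set `A_ν^Ω` of all `m` for which the (closed) support of `Ψ_{ν,m}` meets the open
unit cube `Ω = (0,1)^d`. -/
def cubeIndex {d : ℕ} (ψ₀ ψ₁ : ℝ → ℂ) (ν : Fin d → ℕ) : Set (Fin d → ℤ) :=
  {m | (tsupport (tensorWavelet ψ₀ ψ₁ ν m) ∩ univ.pi fun _ => Ioo (0 : ℝ) 1).Nonempty}

/-! Sequence spaces of dominating mixed smoothness -/

/-- The `ℓ_p` (quasi-)norm, `0 < p ≤ ∞`, of a family in `[0, ∞]`. -/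
def ellNorm {ι : Type*} (p : ℝ≥0∞) (u : ι → ℝ≥0∞) : ℝ≥0∞ :=
  if p = ∞ then ⨆ i, u i else (∑' i, u i ^ p.toReal) ^ (1 / p.toReal)

/-- `|ν|₁`, as a real number. -/
def levelSum {d : ℕ} (ν : Fin d → ℕ) : ℝ := ∑ l, (ν l : ℝ)

/-- The open dyadic box `Q_{ν,m}` with side lengths `2^(-ν_l)` and corner `2^(-ν) m`. -/
def dyadicBox {d : ℕ} (ν : Fin d → ℕ) (m : Fin d → ℤ) : Set (Fin d → ℝ) :=
  {x | ∀ l, (2 : ℝ) ^ (-(ν l : ℤ)) * m l < x l ∧ x l < (2 : ℝ) ^ (-(ν l : ℤ)) * (m l + 1)}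

/-- Families of complex numbers `u_{ν,m}`, `ν ∈ ℕ₀^d`, `m ∈ A ν`. -/
abbrev MixedSeq {d : ℕ} (A : (Fin d → ℕ) → Set (Fin d → ℤ)) : Type :=
  (Σ ν : Fin d → ℕ, A ν) → ℂ

/-- The (quasi-)norm of `s^t_{p,q} b`, with the index sets `A ν`, for `0 < p, q ≤ ∞`. -/
def mixedNormB {d : ℕ} (A : (Fin d → ℕ) → Set (Fin d → ℤ)) (p q : ℝ≥0∞) (t : ℝ)
    (u : MixedSeq A) : ℝ≥0∞ :=
  ellNorm q fun ν : Fin d → ℕ =>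
    (2 : ℝ≥0∞) ^ (levelSum ν * (t - p⁻¹.toReal)) * ellNorm p fun m : A ν => ‖u ⟨ν, m⟩‖ₑ

/-- The (quasi-)norm of `s^t_{p,q} f`, with the index sets `A ν`, for `0 < p < ∞`, `0 < q ≤ ∞`. -/
def mixedNormF {d : ℕ} (A : (Fin d → ℕ) → Set (Fin d → ℤ)) (p : ℝ) (q : ℝ≥0∞) (t : ℝ)
    (u : MixedSeq A) : ℝ≥0∞ :=
  (∫⁻ x : Fin d → ℝ, (ellNorm q fun i : Σ ν : Fin d → ℕ, A ν =>
    (dyadicBox i.1 i.2).indicator (fun _ => (2 : ℝ≥0∞) ^ (levelSum i.1 * t) * ‖u i‖ₑ) x) ^ p)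
      ^ (1 / p)

/-- The closed unit ball of `s^t_{p,q} b`, with the index sets `A ν`. -/
def mixedBallB {d : ℕ} (A : (Fin d → ℕ) → Set (Fin d → ℤ)) (p q : ℝ≥0∞) (t : ℝ) :
    Set (MixedSeq A) :=
  {u | mixedNormB A p q t u ≤ 1}

end

/-! ### Simplicial complexes and the coned skeleton of the cross-polytope -/

section Complexes

/-! All three widths are bounded through one continuous coordinatewise map `T` on `K` whose values
are sparse and close to the identity. Call `|ν|₁` the level of an index, put `e = d - 1` and choose
`J` with `2 ^ J * (J + 1) ^ e` of order `n`, or `J = 0` for small `n`. Below level `J` the map is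
the identity; there are at most a constant times `2 ^ J * (J + 1) ^ e` indices there. From level `J`
on it shrinks each coefficient by a threshold depending on the level, or sets it to zero. The
`ℓ_{p₁}` budget of the ball lets few coefficients survive the threshold
(`exists_threshold_approximation`). For `p₁ = ∞` truncation at level `J` suffices.

From sparsity to widths (`widths_le`): sparse vectors in a multiple of the `ℓ₁`-ball lie in a
skeleton of the cross-polytope coned from its centre, which serves as the `n`-dimensional complex
for the Alexandroff width and the co-width. For the manifold width, `n` Vandermonde measurements
determine the `n / 2`-sparse real vectors in a Lipschitz way, and the inverse extends continuously
to all of `ℝⁿ` (`exists_lipschitz_decoder`). Two points in one fibre of `T` differ by the difference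
of their residuals, so the error bound also bounds the fibres.

The error (`exists_mixedNormF_le`): a residual lives on levels at least `J`, and at almost every
point only one box of each `ν` can contribute to the square function. Hölder's inequality with
weights decaying geometrically in the level bounds the `f`-quasi-norm by a weighted `ℓ_q` sum with
`q ≥ max p₂ 2`, at the price `(J + 1) ^ (e * (1 / 2 - 1 / q))`. Thresholding controls this sum,
since a residual is at most the threshold and at most the coefficient. The result is `2 ^ (-J * t) *
(J + 1) ^ (e * (1 / 2 - 1 / p₁))`, which `rate_le` rewrites in terms of `n`. The wavelets enter only
through the index sets: finitely many indices, `O(2 ^ |ν|₁)` of them for each `ν`, with boxes in a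
fixed cube. -/

/-- The image of a complex under an injective linear map. -/
noncomputable def SimplexComplex.map {E E' : Type*} [AddCommGroup E] [Module ℝ E] [AddCommGroup E']
    [Module ℝ E'] (C : SimplexComplex E) (f : E →ₗ[ℝ] E') (hf : Function.Injective f) :
    SimplexComplex E' where
  faces := (fun s => s.map ⟨f, hf⟩) '' C.faces
  finite_faces := C.finite_faces.image _
  indep := by
    rintro _ ⟨s, hs, rfl⟩
    refine ((C.indep s hs).map' f.toAffineMap hf).range.mono (s := (s.map ⟨f, hf⟩ : Set E')) ?_
    rintro _ hv
    obtain ⟨v, hvs, rfl⟩ := Finset.mem_map.1 hv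
    exact ⟨⟨v, hvs⟩, rfl⟩
  down_closed := by
    classical
    rintro _ ⟨s, hs, rfl⟩ s' hs'
    obtain ⟨u, hu, rfl⟩ := Finset.subset_map_iff.1 hs'
    exact ⟨u, C.down_closed s hs u hu, rfl⟩
  inter := by
    rintro _ ⟨s₁, hs₁, rfl⟩ _ ⟨s₂, hs₂, rfl⟩
    obtain ⟨s, hs, h⟩ := C.inter s₁ hs₁ s₂ hs₂
    refine ⟨_, ⟨s, hs, rfl⟩, ?_⟩
    simp only [Finset.coe_map, Function.Embedding.coeFn_mk, ← LinearMap.image_convexHull]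
    rw [← h, image_inter hf]

theorem SimplexComplex.carrier_map {E E' : Type*} [AddCommGroup E] [Module ℝ E] [AddCommGroup E']
    [Module ℝ E'] (C : SimplexComplex E) (f : E →ₗ[ℝ] E') (hf : Function.Injective f) :
    (C.map f hf).carrier = f '' C.carrier := by
  simp only [carrier, map, image_iUnion, LinearMap.image_convexHull, biUnion_image, Finset.coe_map,
    Function.Embedding.coeFn_mk]

theorem SimplexComplex.HasDim.map {E E' : Type*} [AddCommGroup E] [Module ℝ E] [AddCommGroup E']
    [Module ℝ E'] {C : SimplexComplex E} {n : ℕ} (hC : C.HasDim n) (f : E →ₗ[ℝ] E')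
    (hf : Function.Injective f) : (C.map f hf).HasDim n := by
  refine ⟨?_, ?_⟩
  · rintro _ ⟨s, hs, rfl⟩
    simpa using hC.1 s hs
  · obtain ⟨s, hs, h⟩ := hC.2
    exact ⟨_, ⟨s, hs, rfl⟩, by simpa using h⟩

variable {κ : Type*} [Fintype κ] [DecidableEq κ]

/-- The vertices of the cross-polytope together with its centre. -/
def crossVertices (κ : Type*) [DecidableEq κ] : Set (κ → ℝ) :=
  insert 0 (range (fun i : κ × Bool => Pi.single i.1 (if i.2 then (1 : ℝ) else -1)))

theorem finite_crossVertices : (crossVertices κ).Finite := (finite_range _).insert _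

theorem crossVertices_dotProduct_self {v : κ → ℝ} (hv : v ∈ crossVertices κ) (h0 : v ≠ 0) :
    v ⬝ᵥ v = 1 := by
  rcases hv with rfl | ⟨⟨i, b⟩, rfl⟩
  · exact absurd rfl h0
  · cases b <;> simp

theorem crossVertices_dotProduct_nonpos {v w : κ → ℝ} (hv : v ∈ crossVertices κ)
    (hw : w ∈ crossVertices κ) (h : v ≠ w) : v ⬝ᵥ w ≤ 0 := by
  rcases hv with rfl | ⟨⟨i, b⟩, rfl⟩
  · simp
  rcases hw with rfl | ⟨⟨j, c⟩, rfl⟩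
  · simp
  by_cases hij : i = j
  · subst hij
    cases b <;> cases c <;> simp_all
  · simp [Ne.symm hij]

/-- A combination of pairwise orthogonal vertices determines its weights at nonzero vertices. -/
theorem weight_eq_dotProduct {s : Finset (κ → ℝ)} (hs : (s : Set (κ → ℝ)) ⊆ crossVertices κ)
    (ho : ∀ v ∈ s, ∀ w ∈ s, v ≠ w → v ⬝ᵥ w = 0) (a : (κ → ℝ) → ℝ) {v : κ → ℝ} (hv : v ∈ s)
    (h0 : v ≠ 0) : v ⬝ᵥ (∑ u ∈ s, a u • u) = a v := by
  rw [dotProduct_sum, Finset.sum_eq_single v]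
  · rw [dotProduct_smul, crossVertices_dotProduct_self (hs hv) h0, smul_eq_mul, mul_one]
  · intro u hu huv
    rw [dotProduct_smul, ho v hv u hu huv.symm, smul_zero]
  · exact fun h => absurd hv h

/-- Pairing the common point with `v` yields `a v` from the first representation, by orthogonality,
and a nonpositive number from the second, since distinct vertices have nonpositive inner product.
This forces two simplices to meet only in their common face. -/
theorem weight_eq_zero_of_notMem {s₁ s₂ : Finset (κ → ℝ)} (h₁ : (s₁ : Set (κ → ℝ)) ⊆ crossVertices κ)
    (h₂ : (s₂ : Set (κ → ℝ)) ⊆ crossVertices κ)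
    (ho₁ : ∀ v ∈ s₁, ∀ w ∈ s₁, v ≠ w → v ⬝ᵥ w = 0)
    {a b : (κ → ℝ) → ℝ} (ha : ∀ v ∈ s₁, 0 ≤ a v) (hb : ∀ v ∈ s₂, 0 ≤ b v)
    (hab : ∑ u ∈ s₁, a u • u = ∑ u ∈ s₂, b u • u) {v : κ → ℝ} (hv : v ∈ s₁) (hv' : v ∉ s₂)
    (h0 : v ≠ 0) : a v = 0 := by
  refine le_antisymm ?_ (ha v hv)
  rw [← weight_eq_dotProduct h₁ ho₁ a hv h0, hab, dotProduct_sum]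
  refine Finset.sum_nonpos fun u hu => ?_
  rw [dotProduct_smul]
  refine smul_nonpos_of_nonneg_of_nonpos (hb u hu)
    (crossVertices_dotProduct_nonpos (h₁ hv) (h₂ hu) ?_)
  rintro rfl
  exact hv' hu

open Classical in
/-- The `n`-dimensional skeleton of the cross-polytope, coned off from its centre. -/
noncomputable def crossComplex (κ : Type*) [Fintype κ] [DecidableEq κ] (n : ℕ) :
    SimplexComplex (κ → ℝ) where
  -- Orthogonality excludes exactly the antipodal pairs. The centre is orthogonal to every vertex,
  -- and it is left out of the count so that coning raises the dimension to `n`.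
  faces := {s | (s : Set (κ → ℝ)) ⊆ crossVertices κ ∧ (∀ v ∈ s, ∀ w ∈ s, v ≠ w → v ⬝ᵥ w = 0) ∧
    (s.erase 0).card ≤ n}
  finite_faces := (finite_crossVertices.toFinset.powerset.finite_toSet).subset fun s hs =>
    Finset.mem_coe.2 (Finset.mem_powerset.2 fun _ hv =>
      finite_crossVertices.mem_toFinset.2 (hs.1 hv))
  indep := by
    rintro s ⟨hs, ho, -⟩
    rw [affineIndependent_iff]
    intro T a hsum hT
    have key : ∀ v ∈ T, (v : κ → ℝ) ≠ 0 → a v = 0 := by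
      intro v hv h0
      have h : (v : κ → ℝ) ⬝ᵥ (∑ u ∈ T, a u • (u : κ → ℝ)) = a v := by
        rw [dotProduct_sum, Finset.sum_eq_single v]
        · rw [dotProduct_smul, crossVertices_dotProduct_self (hs v.2) h0, smul_eq_mul, mul_one]
        · intro u hu huv
          rw [dotProduct_smul, ho v v.2 u u.2 fun h => huv (Subtype.ext h.symm), smul_zero]
        · exact fun h => absurd hv h
      rw [← h, hT, dotProduct_zero]
    intro v hv
    by_cases h0 : (v : κ → ℝ) = 0
    · rw [← hsum]
      refine (Finset.sum_eq_single v (fun u hu huv => key u hu fun h => huv ?_)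
        fun h => absurd hv h).symm
      exact Subtype.ext (h.trans h0.symm)
    · exact key v hv h0
  down_closed := by
    rintro s ⟨hs, ho, hn⟩ s' hs'
    exact ⟨fun v hv => hs (hs' hv), fun v hv w hw => ho v (hs' hv) w (hs' hw),
      (Finset.card_le_card (Finset.erase_subset_erase 0 hs')).trans hn⟩
  inter := by
    rintro s₁ ⟨hs₁, ho₁, hn₁⟩ s₂ ⟨hs₂, ho₂, -⟩
    refine ⟨s₁ ∩ s₂, ⟨fun v hv => hs₁ (Finset.mem_inter.1 hv).1, fun v hv w hw =>
      ho₁ v (Finset.mem_inter.1 hv).1 w (Finset.mem_inter.1 hw).1,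
      (Finset.card_le_card (Finset.erase_subset_erase 0 Finset.inter_subset_left)).trans hn₁⟩, ?_⟩
    apply Subset.antisymm
    · rintro x ⟨hx₁, hx₂⟩
      obtain ⟨a, ha, ha1, hax⟩ := Finset.mem_convexHull'.1 hx₁
      obtain ⟨b, hb, hb1, hbx⟩ := Finset.mem_convexHull'.1 hx₂
      have ha0 : ∀ v ∈ s₁, v ∉ s₂ → v ≠ 0 → a v = 0 := fun v hv hv' h0 =>
        weight_eq_zero_of_notMem hs₁ hs₂ ho₁ ha hb (hax.trans hbx.symm) hv hv' h0
      have hb0 : ∀ v ∈ s₂, v ∉ s₁ → v ≠ 0 → b v = 0 := fun v hv hv' h0 =>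
        weight_eq_zero_of_notMem hs₂ hs₁ ho₂ hb ha (hbx.trans hax.symm) hv hv' h0
      have hab : ∀ v ∈ s₁, v ∈ s₂ → v ≠ 0 → a v = b v := fun v hv hv' h0 => by
        rw [← weight_eq_dotProduct hs₁ ho₁ a hv h0, ← weight_eq_dotProduct hs₂ ho₂ b hv' h0, hax,
          hbx]
      -- Inner products do not see the weight at the centre. If `0` belongs to `s₁` only, the second
      -- representation shows that the weights at the common vertices already sum to `1`, so nothing
      -- is left for `0`.
      have ha00 : ∀ v ∈ s₁, v ∉ s₂ → a v = 0 := by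
        intro v hv hv'
        by_cases h0 : v = 0
        · subst h0
          have e1 : ∑ u ∈ s₁.erase 0, a u = 1 := by
            rw [← hb1, ← Finset.sum_subset (s₁ := s₁ ∩ s₂) (s₂ := s₂) Finset.inter_subset_right,
              ← Finset.sum_subset (s₁ := s₁ ∩ s₂) (s₂ := s₁.erase 0)]
            · refine Finset.sum_congr rfl fun u hu => ?_
              have hu' := Finset.mem_inter.1 hu
              exact hab u hu'.1 hu'.2 fun h => hv' (h ▸ hu'.2)
            · intro u hu
              have hu' := Finset.mem_inter.1 hu
              exact Finset.mem_erase.2 ⟨fun h => hv' (h ▸ hu'.2), hu'.1⟩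
            · intro u hu hu'
              have h := Finset.mem_erase.1 hu
              exact ha0 u h.2 (fun h2 => hu' (Finset.mem_inter.2 ⟨h.2, h2⟩)) h.1
            · intro u hu hu'
              exact hb0 u hu (fun h2 => hu' (Finset.mem_inter.2 ⟨h2, hu⟩)) fun h => hv' (h ▸ hu)
          have e2 := Finset.add_sum_erase s₁ a hv
          linarith
        · exact ha0 v hv hv' h0
      rw [Finset.mem_convexHull']
      refine ⟨a, fun v hv => ha v (Finset.mem_inter.1 hv).1, ?_, ?_⟩
      · rw [← ha1]
        refine Finset.sum_subset Finset.inter_subset_left fun v hv hv' => ?_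
        exact ha00 v hv fun h => hv' (Finset.mem_inter.2 ⟨hv, h⟩)
      · rw [← hax]
        refine Finset.sum_subset Finset.inter_subset_left fun v hv hv' => ?_
        rw [ha00 v hv fun h => hv' (Finset.mem_inter.2 ⟨hv, h⟩), zero_smul]
    · refine subset_inter (convexHull_mono ?_) (convexHull_mono ?_)
      · exact fun v hv => (Finset.mem_inter.1 hv).1
      · exact fun v hv => (Finset.mem_inter.1 hv).2

theorem crossComplex_hasDim {n : ℕ} (hn : n ≤ Fintype.card κ) : (crossComplex κ n).HasDim n := by
  classical
  refine ⟨?_, ?_⟩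
  · rintro s ⟨-, -, h⟩
    have := Finset.pred_card_le_card_erase (s := s) (a := 0)
    omega
  · obtain ⟨S, -, hS⟩ := Finset.exists_subset_card_eq (s := (Finset.univ : Finset κ)) hn
    have hinj : Function.Injective fun i : κ => (Pi.single i (1 : ℝ) : κ → ℝ) :=
      fun i j hij => by
        by_contra h
        simpa [h] using congrFun hij i
    have h0 : (0 : κ → ℝ) ∉ S.image fun i => (Pi.single i (1 : ℝ) : κ → ℝ) := by
      intro h
      obtain ⟨i, -, hi⟩ := Finset.mem_image.1 h
      simp at hi
    refine ⟨insert 0 (S.image fun i => Pi.single i (1 : ℝ)), ⟨?_, ?_, ?_⟩, ?_⟩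
    · intro v hv
      rcases Finset.mem_insert.1 hv with rfl | hv
      · exact mem_insert _ _
      · obtain ⟨i, -, rfl⟩ := Finset.mem_image.1 hv
        exact mem_insert_of_mem _ ⟨(i, true), by simp⟩
    · intro v hv w hw hvw
      rcases Finset.mem_insert.1 hv with rfl | hv
      · simp
      rcases Finset.mem_insert.1 hw with rfl | hw
      · simp
      obtain ⟨i, -, rfl⟩ := Finset.mem_image.1 hv
      obtain ⟨j, -, rfl⟩ := Finset.mem_image.1 hw
      have : i ≠ j := fun h => hvw (by rw [h])
      simp [this.symm]
    · rw [Finset.erase_insert h0, Finset.card_image_of_injective _ hinj, hS]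
    · rw [Finset.card_insert_of_notMem h0, Finset.card_image_of_injective _ hinj, hS]

/-- Sparse vectors in the `ℓ₁`-ball lie in the skeleton. -/
theorem mem_crossComplex_carrier {n : ℕ} {x : κ → ℝ} (h1 : ∑ i, |x i| ≤ 1)
    (hn : (Finset.univ.filter fun i => x i ≠ 0).card ≤ n) : x ∈ (crossComplex κ n).carrier := by
  classical
  set S := Finset.univ.filter fun i => x i ≠ 0 with hS
  set e : κ → κ → ℝ := fun i => Pi.single i (if 0 < x i then (1 : ℝ) else -1) with he
  have hmem : ∀ i, e i ∈ crossVertices κ := fun i =>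
    mem_insert_of_mem _ ⟨(i, decide (0 < x i)), by simp [he]⟩
  refine mem_biUnion (x := insert 0 (S.image e)) ⟨?_, ?_, ?_⟩ ?_
  · intro v hv
    rcases Finset.mem_insert.1 hv with rfl | hv
    · exact mem_insert _ _
    · obtain ⟨i, -, rfl⟩ := Finset.mem_image.1 hv
      exact hmem i
  · intro v hv w hw hvw
    rcases Finset.mem_insert.1 hv with rfl | hv
    · simp
    rcases Finset.mem_insert.1 hw with rfl | hw
    · simp
    obtain ⟨i, -, rfl⟩ := Finset.mem_image.1 hv
    obtain ⟨j, -, rfl⟩ := Finset.mem_image.1 hw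
    have : i ≠ j := fun h => hvw (by rw [h])
    simp [he, this.symm]
  · refine (Finset.card_le_card ?_).trans ((Finset.card_image_le (s := S) (f := e)).trans hn)
    intro v hv
    have := Finset.mem_erase.1 hv
    exact (Finset.mem_insert.1 this.2).resolve_left this.1
  · have hc := convex_convexHull ℝ ((insert 0 (S.image e) : Finset (κ → ℝ)) : Set (κ → ℝ))
    -- The centre, indexed by `none`, absorbs the missing mass `1 - ∑ |x i|`; indices with `x i = 0`
    -- carry weight zero.
    have hx : x = ∑ i : Option κ, (i.elim (1 - ∑ i, |x i|) fun i => |x i|) •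
        (i.elim (0 : κ → ℝ) fun i => if i ∈ S then e i else 0) := by
      rw [Fintype.sum_option]
      simp only [Option.elim, smul_zero, zero_add]
      ext j
      rw [Finset.sum_apply, Finset.sum_eq_single j]
      · by_cases hj : x j = 0
        · simp [hj]
        · have : j ∈ S := by simp [hS, hj]
          simp only [this, if_true, he, Pi.smul_apply, Pi.single_eq_same, smul_eq_mul]
          split_ifs with h
          · rw [abs_of_pos h, mul_one]
          · rw [abs_of_nonpos (not_lt.1 h)]; ring
      · intro i _ hij
        split_ifs <;> simp [he, hij.symm]
      · simp
    rw [hx]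
    refine hc.sum_mem ?_ ?_ ?_
    · rintro (_ | i) -
      · simpa using h1
      · simp
    · rw [Fintype.sum_option]
      simp
    · rintro (_ | i) -
      · exact subset_convexHull _ _ (by simp)
      · refine subset_convexHull _ _ ?_
        simp only [Option.elim]
        split_ifs with h
        · exact Finset.mem_coe.2 (Finset.mem_insert_of_mem (Finset.mem_image_of_mem _ h))
        · simp

end Complexes

/-! ### From continuous sparse approximation to the three widths -/

section SparseWidths

open Filter Topology

/-- A linear map to `ℝⁿ` with a Lipschitz map that reconstructs all vectors with at most `n / 2`
nonzero entries. -/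
theorem exists_lipschitz_decoder (κ : Type*) [Fintype κ] (n : ℕ) :
    ∃ (A : (κ → ℝ) →ₗ[ℝ] (Fin n → ℝ)) (g : (Fin n → ℝ) → (κ → ℝ)), Continuous g ∧
      ∀ x : κ → ℝ, 2 * (Finset.univ.filter fun k => x k ≠ 0).card ≤ n → g (A x) = x := by
  classical
  -- Distinct nodes, so that `A` records the first `n` power moments of `x`.
  set c : κ → ℝ := fun k => ((Fintype.equivFin κ k : ℕ) : ℝ) with hc
  have hcinj : Function.Injective c := fun k l h =>
    (Fintype.equivFin κ).injective (Fin.ext (Nat.cast_injective h))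
  set A : (κ → ℝ) →ₗ[ℝ] (Fin n → ℝ) :=
    LinearMap.pi fun r => ∑ k, (c k ^ (r : ℕ)) • LinearMap.proj k with hA
  have hAapp : ∀ x r, A x r = ∑ k, c k ^ (r : ℕ) * x k := by
    intro x r
    simp [hA]
  -- On a support of at most `n` indices the first `S.card` rows form an invertible Vandermonde
  -- matrix.
  have hker : ∀ S : Finset κ, S.card ≤ n → ∀ x : κ → ℝ, (∀ k ∉ S, x k = 0) → A x = 0 → x = 0 := by
    intro S hS x hx hAx
    have h := Matrix.eq_zero_of_forall_pow_sum_mul_pow_eq_zero (n := S.card)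
      (f := fun j => c (S.equivFin.symm j)) (v := fun j => x (S.equivFin.symm j))
      (hcinj.comp (Subtype.val_injective.comp S.equivFin.symm.injective)) (by
        intro i
        have h1 := congrFun hAx ⟨i, i.2.trans_le hS⟩
        rw [hAapp] at h1
        rw [← h1.trans (Pi.zero_apply _), ← Finset.sum_subset S.subset_univ (fun k _ hk => by
          rw [hx k hk, mul_zero]), ← Finset.sum_coe_sort S]
        refine (Fintype.sum_equiv S.equivFin.symm _ _ fun j => ?_)
        rw [mul_comm])
    funext k
    by_cases hk : k ∈ S
    · have := congrFun h (S.equivFin ⟨k, hk⟩)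
      simpa using this
    · exact hx k hk
  have hanti : ∀ S : Finset κ, S.card ≤ n → ∃ K : NNReal, ∀ x : κ → ℝ, (∀ k ∉ S, x k = 0) →
      ‖x‖ ≤ K * ‖A x‖ := by
    intro S hS
    set V : Submodule ℝ (κ → ℝ) := Submodule.pi (univ : Set κ) fun k => if k ∈ S then ⊤ else ⊥
    have hV : ∀ x, x ∈ V ↔ ∀ k ∉ S, x k = 0 := by
      intro x
      simp only [V, Submodule.mem_pi, mem_univ, forall_true_left]
      refine forall_congr' fun k => ?_
      by_cases hk : k ∈ S <;> simp [hk]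
    obtain ⟨K, -, hK⟩ := (A.domRestrict V).exists_antilipschitzWith (by
      rw [LinearMap.ker_eq_bot']
      rintro ⟨x, hx⟩ h
      exact Subtype.ext (hker S hS x ((hV x).1 hx) h))
    refine ⟨K, fun x hx => ?_⟩
    exact hK.le_mul_norm (f := A.domRestrict V) (map_zero _) ⟨x, (hV x).2 hx⟩
  choose! Kf hKf using hanti
  set K : NNReal := ∑ S : Finset κ, Kf S
  set D : Set (κ → ℝ) := {x | 2 * (Finset.univ.filter fun k => x k ≠ 0).card ≤ n} with hD
  -- The difference of two `n / 2`-sparse vectors has at most `n` nonzero entries. There are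
  -- finitely many supports, so the sum of their constants works for all.
  have hdist : ∀ x ∈ D, ∀ y ∈ D, dist x y ≤ K * dist (A x) (A y) := by
    intro x hx y hy
    have h := hKf ((Finset.univ.filter fun k => x k ≠ 0) ∪ Finset.univ.filter fun k => y k ≠ 0) (by
      refine (Finset.card_union_le _ _).trans ?_
      simp only [hD, mem_ofPred_eq] at hx hy
      omega) (x - y) (by
        intro k hk
        simp only [Finset.mem_union, Finset.mem_filter, Finset.mem_univ, true_and, not_or,
          not_not] at hk
        simp [hk.1, hk.2])
    rw [dist_eq_norm, dist_eq_norm, ← map_sub]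
    refine h.trans (mul_le_mul_of_nonneg_right ?_ (norm_nonneg _))
    exact_mod_cast Finset.single_le_sum (f := Kf) (fun _ _ => zero_le) (Finset.mem_univ _)
  have hinj : InjOn A D := by
    intro x hx y hy h
    have := hdist x hx y hy
    rw [h, dist_self, mul_zero] at this
    exact dist_le_zero.1 this
  have hlip : LipschitzOnWith K (Function.invFunOn A D) (A '' D) := by
    refine LipschitzOnWith.of_dist_le_mul ?_
    rintro _ ⟨x, hx, rfl⟩ _ ⟨y, hy, rfl⟩
    rw [hinj.leftInvOn_invFunOn hx, hinj.leftInvOn_invFunOn hy]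
    exact hdist x hx y hy
  -- Real-valued Lipschitz functions extend from any subset; this is applied to each coordinate.
  obtain ⟨g, hg, hgA⟩ := hlip.extend_pi
  refine ⟨A, g, hg.continuous, fun x hx => ?_⟩
  rw [← hgA (mem_image_of_mem A hx), hinj.leftInvOn_invFunOn hx]

variable {ι : Type} {N : (ι → ℂ) → ℝ≥0∞}

/-- The gauge topology is finer than the topology of pointwise convergence. -/
theorem exists_gauge_lt_of_mem_nhds (hN : ∀ i, ∃ C : ℝ≥0∞, C ≠ ∞ ∧ ∀ u, ‖u i‖ₑ ≤ C * N u)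
    {x : ι → ℂ} {U : Set (ι → ℂ)} (hU : U ∈ 𝓝 x) : ∃ δ > 0, ∀ y, N (y - x) < δ → y ∈ U := by
  have hle : comap (fun y => N (y - x)) (𝓝 0) ≤ 𝓝 x := by
    rw [nhds_pi, Filter.le_pi]
    intro i
    obtain ⟨C, hC, h⟩ := hN i
    rw [tendsto_iff_edist_tendsto_0]
    have h1 : Tendsto (fun y => C * N (y - x)) (comap (fun y => N (y - x)) (𝓝 0)) (𝓝 0) := by
      have := ENNReal.Tendsto.const_mul (a := C) (tendsto_comap (f := fun y => N (y - x))
        (x := 𝓝 0)) (Or.inr hC)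
      rwa [mul_zero] at this
    refine tendsto_of_tendsto_of_tendsto_of_le_of_le tendsto_const_nhds h1
      (fun _ => zero_le) fun y => ?_
    rw [edist_eq_enorm_sub]
    exact h (y - x)
  obtain ⟨V, hV, hVU⟩ := mem_comap.1 (hle hU)
  obtain ⟨δ, hδ, h⟩ := (ENNReal.nhds_zero_basis.mem_iff).1 hV
  exact ⟨δ, hδ, fun y hy => hVU (h hy)⟩

/-- Pointwise continuity implies gauge continuity for maps with finitely many coordinates. -/
theorem eventually_gauge_lt {W : Type*} [TopologicalSpace W]
    (hN : ∀ I : Finset ι, ∃ C : ℝ≥0∞, C ≠ ∞ ∧ ∀ u : ι → ℂ, (∀ i ∉ I, u i = 0) →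
      ∀ η : ℝ≥0∞, (∀ i, ‖u i‖ₑ ≤ η) → N u ≤ C * η)
    {f : W → ι → ℂ} (hf : Continuous f) {I : Finset ι} (hI : ∀ i ∉ I, ∀ y, f y i = 0) (x : W)
    {ε : ℝ≥0∞} (hε : 0 < ε) : ∀ᶠ y in 𝓝 x, N (f y - f x) < ε := by
  obtain ⟨C, hC, h⟩ := hN I
  obtain ⟨η, hη, hηε⟩ := ENNReal.exists_nnreal_pos_mul_lt hC hε.ne'
  have h1 : ∀ᶠ y in 𝓝 x, ∀ i ∈ I, edist (f y i) (f x i) < η := by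
    rw [Filter.eventually_all_finset]
    intro i _
    exact (tendsto_iff_edist_tendsto_0.1 (((continuous_apply i).comp hf).tendsto x)).eventually
      (gt_mem_nhds (by exact_mod_cast hη))
  filter_upwards [h1] with y hy
  refine (h (f y - f x) (fun i hi => by simp [hI i hi]) η fun i => ?_).trans_lt
    (by rwa [mul_comm])
  by_cases hi : i ∈ I
  · have := (hy i hi).le
    rwa [edist_eq_enorm_sub] at this
  · simp [hI i hi]

/-- The vector with prescribed real and imaginary parts on a finite set of coordinates. -/
noncomputable def coordMap (I : Finset ι) : (I × Bool → ℝ) →ₗ[ℝ] (ι → ℂ) := by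
  classical
  exact
  { toFun := fun y i => if h : i ∈ I then ⟨y (⟨i, h⟩, true), y (⟨i, h⟩, false)⟩ else 0
    map_add' := fun y z => by
      funext i
      by_cases h : i ∈ I
      · apply Complex.ext <;> simp [h]
      · simp [h]
    map_smul' := fun c y => by
      funext i
      by_cases h : i ∈ I
      · apply Complex.ext <;> simp [h]
      · simp [h] }

theorem coordMap_of_mem {I : Finset ι} (y : I × Bool → ℝ) {i : ι} (h : i ∈ I) :
    coordMap I y i = ⟨y (⟨i, h⟩, true), y (⟨i, h⟩, false)⟩ := dif_pos h

theorem coordMap_of_notMem {I : Finset ι} (y : I × Bool → ℝ) {i : ι} (h : i ∉ I) :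
    coordMap I y i = 0 := dif_neg h

theorem coordMap_injective (I : Finset ι) : Function.Injective (coordMap I) := by
  intro y z h
  funext ⟨⟨i, hi⟩, b⟩
  have := congrFun h i
  rw [coordMap_of_mem y hi, coordMap_of_mem z hi, Complex.mk.injEq] at this
  cases b
  · exact this.2
  · exact this.1

theorem continuous_coordMap (I : Finset ι) : Continuous (coordMap I) :=
  (coordMap I).continuous_on_pi

/-- Upper bounds for the nonlinear widths from a continuous sparse approximation. -/
theorem widths_le [Infinite ι]
    (hN₁ : ∀ I : Finset ι, ∃ C : ℝ≥0∞, C ≠ ∞ ∧ ∀ u : ι → ℂ, (∀ i ∉ I, u i = 0) →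
      ∀ η : ℝ≥0∞, (∀ i, ‖u i‖ₑ ≤ η) → N u ≤ C * η)
    (hN₂ : ∀ i, ∃ C : ℝ≥0∞, C ≠ ∞ ∧ ∀ u, ‖u i‖ₑ ≤ C * N u)
    {K : Set (ι → ℂ)} (hK : ∀ i, ∃ B : ℝ, ∀ u ∈ K, ‖u i‖ ≤ B)
    {T : ι → ℂ → ℂ} (hT : ∀ i, Continuous (T i)) {I : Finset ι} (hI : ∀ i ∉ I, ∀ z, T i z = 0)
    {n : ℕ} (hn : ∀ u ∈ K, 4 * (I.filter fun i => T i (u i) ≠ 0).card ≤ n) {ε : ℝ≥0∞}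
    (hε₁ : ∀ u ∈ K, N (u - fun i => T i (u i)) ≤ ε)
    (hε₂ : ∀ u ∈ K, ∀ v ∈ K, (∀ i, T i (u i) = T i (v i)) → N (u - v) ≤ ε) :
    alexandroffWidth N K n ≤ ε ∧ coWidth N K n ≤ ε ∧ manifoldWidth N K n ≤ ε := by
  classical
  -- At least `n` coordinates are needed for the complex to have dimension exactly `n`; the infinite
  -- index set provides them.
  obtain ⟨I', hII', hcard⟩ := Infinite.exists_superset_card_eq I (max n I.card) (le_max_right _ _)
  have hI' : ∀ i ∉ I', ∀ z, T i z = 0 := fun i hi => hI i fun h => hi (hII' h)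
  set H : (ι → ℂ) → (I' × Bool → ℝ) := fun u k =>
    if k.2 then (T k.1 (u k.1)).re else (T k.1 (u k.1)).im with hH
  have hHcont : Continuous H := by
    refine continuous_pi fun ⟨i, b⟩ => ?_
    cases b
    · exact Complex.continuous_im.comp ((hT i).comp (continuous_apply _))
    · exact Complex.continuous_re.comp ((hT i).comp (continuous_apply _))
  have hcoord : ∀ u, coordMap I' (H u) = fun i => T i (u i) := by
    intro u
    funext i
    by_cases hi : i ∈ I'
    · rw [coordMap_of_mem _ hi]
      simp [hH]
    · rw [coordMap_of_notMem _ hi, hI' i hi]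
  -- The factor `4` splits in two: each complex entry has two real parts, and the decoder needs
  -- sparsity `n / 2`.
  have hsupp : ∀ u ∈ K, 2 * (Finset.univ.filter fun k => H u k ≠ 0).card ≤ n := by
    intro u hu
    have h1 : (Finset.univ.filter fun k => H u k ≠ 0).card ≤
        ((I.filter fun i => T i (u i) ≠ 0) ×ˢ (Finset.univ : Finset Bool)).card := by
      refine Finset.card_le_card_of_injOn (fun k => (k.1.1, k.2)) ?_ ?_
      · rintro ⟨i, b⟩ hk
        have hk' : H u (i, b) ≠ 0 := (Finset.mem_filter.1 hk).2
        have hne : T i (u i) ≠ 0 := by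
          intro h
          refine hk' ?_
          cases b <;> simp [hH, h]
        simp only [Finset.coe_product, mem_prod, Finset.mem_coe, Finset.mem_univ, and_true,
          Finset.mem_filter]
        exact ⟨by_contra fun h => hne (hI _ h _), hne⟩
      · rintro ⟨⟨i, hi⟩, b⟩ - ⟨⟨j, hj⟩, c⟩ - h
        simpa using h
    rw [Finset.card_product, Finset.card_univ, Fintype.card_bool] at h1
    have := hn u hu
    omega
  have hTB : ∀ i, ∃ B : ℝ, ∀ u ∈ K, ‖T i (u i)‖ ≤ B := by
    intro i
    obtain ⟨B, hB⟩ := hK i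
    obtain ⟨B', hB'⟩ := (isCompact_closedBall (0 : ℂ) B).exists_bound_of_continuousOn
      (hT i).continuousOn
    exact ⟨B', fun u hu => hB' _ (by simpa using hB u hu)⟩
  choose B hB using hTB
  -- The coordinates are bounded on `K`, so dilation by `R⁻¹` brings all values into the unit
  -- `ℓ₁`-ball.
  obtain ⟨R, hR0, hR⟩ : ∃ R : ℝ, 0 < R ∧ ∀ u ∈ K, ∑ k, |H u k| ≤ R := by
    refine ⟨max 1 (∑ k : I' × Bool, B k.1), lt_max_of_lt_left one_pos, fun u hu => ?_⟩
    refine (Finset.sum_le_sum fun k _ => ?_).trans (le_max_right _ _)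
    refine le_trans ?_ (hB k.1 u hu)
    simp only [hH]
    split_ifs
    · exact Complex.abs_re_le_norm _
    · exact Complex.abs_im_le_norm _
  have hmem : ∀ u ∈ K, R⁻¹ • H u ∈ (crossComplex (I' × Bool) n).carrier := by
    intro u hu
    refine mem_crossComplex_carrier ?_ ?_
    · simp only [Pi.smul_apply, smul_eq_mul, abs_mul, abs_of_pos (inv_pos.2 hR0)]
      rw [← Finset.mul_sum, inv_mul_le_iff₀ hR0, mul_one]
      exact hR u hu
    · have := hsupp u hu
      simp only [Pi.smul_apply, smul_eq_mul, ne_eq, mul_eq_zero, inv_eq_zero, hR0.ne', false_or]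
      simp only [ne_eq] at this
      omega
  have hdim : (crossComplex (I' × Bool) n).HasDim n := by
    refine crossComplex_hasDim ?_
    rw [Fintype.card_prod, Fintype.card_coe, hcard, Fintype.card_bool]
    have := le_max_left n I.card
    omega
  have hfin : ∀ y, N (coordMap I' y) < ∞ := by
    intro y
    obtain ⟨C, hC, h⟩ := hN₁ I'
    refine (h _ (fun i hi => coordMap_of_notMem y hi) (∑ i ∈ I', ‖coordMap I' y i‖ₑ)
      fun i => ?_).trans_lt (ENNReal.mul_lt_top hC.lt_top ?_)
    · by_cases hi : i ∈ I'
      · exact Finset.single_le_sum (f := fun i => ‖coordMap I' y i‖ₑ) (fun _ _ => zero_le) hi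
      · simp [coordMap_of_notMem y hi]
    · exact ENNReal.sum_lt_top.2 fun i _ => enorm_lt_top
  have hcontN : ∀ {V : Type} [NormedAddCommGroup V] (G : (ι → ℂ) → V), Continuous G →
      GaugeContinuousOn N (fun v => ‖v‖ₑ) G K := by
    intro V _ G hG x _ ε hε
    have h1 : ∀ᶠ y in 𝓝 x, edist (G y) (G x) < ε :=
      (tendsto_iff_edist_tendsto_0.1 (hG.tendsto x)).eventually (gt_mem_nhds hε)
    obtain ⟨δ, hδ, h⟩ := exists_gauge_lt_of_mem_nhds hN₂ h1
    exact ⟨δ, hδ, fun y _ hy => by simpa [edist_eq_enorm_sub] using h y hy⟩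
  refine ⟨?_, ?_, ?_⟩
  · have hinj : Function.Injective (coordMap I' ∘ₗ (R • LinearMap.id)) :=
      (coordMap_injective I').comp (smul_right_injective _ hR0.ne')
    refine iInf_le_of_le ((crossComplex (I' × Bool) n).map _ hinj) <|
      iInf_le_of_le (hdim.map _ hinj) <| iInf_le_of_le ?_ <|
      iInf_le_of_le (fun u i => T i (u i)) <| iInf_le_of_le ?_ <| iInf_le_of_le ?_ ?_
    · rintro _ ⟨s, hs, rfl⟩ v hv
      obtain ⟨w, -, rfl⟩ := Finset.mem_map.1 hv
      exact hfin _
    · intro x _ ε hε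
      obtain ⟨δ, hδ, h⟩ := exists_gauge_lt_of_mem_nhds hN₂ (eventually_gauge_lt hN₁
        (f := fun u i => T i (u i))
        (continuous_pi fun i => by exact (hT i).comp (continuous_apply i)) (fun i hi y => hI i hi _) x hε)
      exact ⟨δ, hδ, fun y _ hy => h y hy⟩
    · intro u hu
      rw [SimplexComplex.carrier_map]
      refine ⟨_, hmem u hu, ?_⟩
      rw [LinearMap.comp_apply, LinearMap.smul_apply, LinearMap.id_apply, smul_smul,
        mul_inv_cancel₀ hR0.ne', one_smul, hcoord]
    · exact iSup₂_le hε₁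
  · refine iInf_le_of_le (I' × Bool → ℝ) <| iInf_le_of_le inferInstance <|
      iInf_le_of_le inferInstance <| iInf_le_of_le (crossComplex (I' × Bool) n) <|
      iInf_le_of_le hdim <| iInf_le_of_le (fun u => R⁻¹ • H u) <|
      iInf_le_of_le (hcontN _ (by exact hHcont.const_smul (R⁻¹ : ℝ))) <| iInf_le_of_le hmem ?_
    refine iSup₂_le fun x _ => iSup₂_le fun u hu => iSup₂_le fun v hv => hε₂ u hu.1 v hv.1 ?_
    have h1 : H u = H v :=
      smul_right_injective _ (inv_ne_zero hR0.ne') (hu.2.trans hv.2.symm)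
    intro i
    have := (hcoord u).symm.trans ((congrArg (coordMap I') h1).trans (hcoord v))
    exact congrFun this i
  · obtain ⟨A, g, hg, hgA⟩ := exists_lipschitz_decoder (I' × Bool) n
    have hM : Continuous fun y : EuclideanSpace ℝ (Fin n) =>
        coordMap I' (g (WithLp.ofLp y)) :=
      (continuous_coordMap I').comp (hg.comp (PiLp.continuous_ofLp 2 _))
    refine iInf_le_of_le (fun u => WithLp.toLp 2 (A (H u))) <|
      iInf_le_of_le (hcontN _ ?_) <|
      iInf_le_of_le (fun y => coordMap I' (g (WithLp.ofLp y))) <|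
      iInf_le_of_le (fun y => hfin _) <| iInf_le_of_le ?_ ?_
    · exact (PiLp.continuous_toLp 2 _).comp (A.continuous_on_pi.comp hHcont)
    · intro x _ ε hε
      have h1 := eventually_gauge_lt hN₁ hM (fun i hi y => coordMap_of_notMem _ hi) x hε
      obtain ⟨δ, hδ, h⟩ := EMetric.mem_nhds_iff.1 h1
      exact ⟨δ, hδ, fun y _ hy => h (by rwa [Metric.mem_eball, edist_eq_enorm_sub])⟩
    · refine iSup₂_le fun u hu => ?_
      have : coordMap I' (g (WithLp.ofLp (WithLp.toLp 2 (A (H u))))) = fun i => T i (u i) := by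
        rw [WithLp.ofLp_toLp, hgA _ (hsupp u hu), hcoord]
      change N (u - coordMap I' (g (WithLp.ofLp (WithLp.toLp 2 (A (H u)))))) ≤ ε
      rw [this]
      exact hε₁ u hu

end SparseWidths

/-! ### Counting and summing over the levels `|ν|₁` -/

section LevelSums

/-- The sum and the last `e` coordinates determine the first one, so at most `(j + 1) ^ e`
multi-indices have level `j`. -/
theorem tsum_sum_coords_le (e : ℕ) (f : ℕ → ℝ≥0∞) :
    ∑' ν : Fin (e + 1) → ℕ, f (∑ l, ν l) ≤ ∑' j : ℕ, ((j : ℝ≥0∞) + 1) ^ e * f j := by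
  rw [← (Equiv.sigmaFiberEquiv fun ν : Fin (e + 1) → ℕ => ∑ l, ν l).tsum_eq, ENNReal.tsum_sigma']
  refine ENNReal.tsum_le_tsum fun j => ?_
  have h1 : ∀ x : {ν : Fin (e + 1) → ℕ // ∑ l, ν l = j},
      f (∑ l, (Equiv.sigmaFiberEquiv fun ν : Fin (e + 1) → ℕ => ∑ l, ν l) ⟨j, x⟩ l) = f j :=
    fun x => congrArg f x.2
  simp_rw [h1]
  have hle : ∀ (x : {ν : Fin (e + 1) → ℕ // ∑ l, ν l = j}) (l), x.1 l < j + 1 := fun x l =>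
    Nat.lt_succ_of_le ((Finset.single_le_sum (f := x.1) (fun _ _ => Nat.zero_le _)
      (Finset.mem_univ l)).trans x.2.le)
  let φ : {ν : Fin (e + 1) → ℕ // ∑ l, ν l = j} → (Fin e → Fin (j + 1)) := fun x l =>
    ⟨x.1 l.succ, hle x _⟩
  have hφ : Function.Injective φ := by
    intro x y h
    have h2 : ∀ l : Fin e, x.1 l.succ = y.1 l.succ := fun l =>
      congrArg Fin.val (congrFun h l)
    have h3 := x.2.trans y.2.symm
    rw [Fin.sum_univ_succ, Fin.sum_univ_succ, Finset.sum_congr rfl fun l _ => h2 l] at h3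
    refine Subtype.ext (funext fun l => ?_)
    refine Fin.cases ?_ h2 l
    exact Nat.add_right_cancel h3
  refine (ENNReal.tsum_comp_le_tsum_of_injective hφ fun _ => f j).trans ?_
  rw [tsum_fintype, Finset.sum_const, Finset.card_univ, Fintype.card_fun, Fintype.card_fin,
    Fintype.card_fin, nsmul_eq_mul]
  push_cast
  rfl

theorem summable_add_one_pow_mul_geometric (e : ℕ) {r : ℝ} (h0 : 0 < r) (h1 : r < 1) :
    Summable fun k : ℕ => ((k : ℝ) + 1) ^ e * r ^ k := by
  have hr : ‖r‖ < 1 := by rwa [Real.norm_of_nonneg h0.le]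
  have h : Summable fun k : ℕ => (k : ℝ) ^ e * r ^ k :=
    summable_pow_mul_geometric_of_norm_lt_one e hr
  have h' : Summable fun k : ℕ => ((k + 1 : ℕ) : ℝ) ^ e * r ^ (k + 1) :=
    (summable_nat_add_iff (f := fun k : ℕ => (k : ℝ) ^ e * r ^ k) 1).2 h
  refine (h'.mul_left r⁻¹).congr fun k => ?_
  rw [pow_succ r, mul_left_comm, mul_comm (r ^ k), inv_mul_cancel_left₀ h0.ne', Nat.cast_succ]

/-- Summation of geometrically decaying weights over all levels above `J`. -/
theorem exists_tsum_level_weight_le (e : ℕ) {δ : ℝ} (hδ : 0 < δ) :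
    ∃ C : ℝ≥0∞, C ≠ ∞ ∧ ∀ J : ℕ,
      ∑' ν : Fin (e + 1) → ℕ, (if J ≤ ∑ l, ν l then
        (2 : ℝ≥0∞) ^ (-(δ * (((∑ l, ν l : ℕ) : ℝ) - J))) else 0) ≤ C * ((J : ℝ≥0∞) + 1) ^ e := by
  -- With `j = J + k`, the inequality `J + k + 1 ≤ (J + 1) * (k + 1)` separates the factor in `J`
  -- from a convergent series in `k`.
  refine ⟨∑' k : ℕ, ((k : ℝ≥0∞) + 1) ^ e * (2 : ℝ≥0∞) ^ (-(δ * (k : ℝ))), ?_, fun J => ?_⟩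
  · have hr0 : (0 : ℝ) < 2 ^ (-δ) := Real.rpow_pos_of_pos two_pos _
    have hr1 : (2 : ℝ) ^ (-δ) < 1 :=
      Real.rpow_lt_one_of_one_lt_of_neg one_lt_two (neg_neg_of_pos hδ)
    refine ne_of_eq_of_ne (tsum_congr fun k => ?_)
      (summable_add_one_pow_mul_geometric e hr0 hr1).tsum_ofReal_ne_top
    rw [ENNReal.ofReal_mul (by positivity), ENNReal.ofReal_pow (by positivity),
      ENNReal.ofReal_pow hr0.le, ENNReal.ofReal_add (by positivity) zero_le_one,
      ENNReal.ofReal_natCast, ENNReal.ofReal_one, ← ENNReal.ofReal_rpow_of_pos two_pos,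
      ENNReal.ofReal_ofNat, ← ENNReal.rpow_natCast _ k, ← ENNReal.rpow_mul, neg_mul]
  · refine (tsum_sum_coords_le e fun j => if J ≤ j then
      (2 : ℝ≥0∞) ^ (-(δ * ((j : ℝ) - J))) else 0).trans ?_
    rw [← (add_right_injective J).tsum_eq, mul_comm, ← ENNReal.tsum_mul_left]
    · refine ENNReal.tsum_le_tsum fun k => ?_
      rw [if_pos (Nat.le_add_right J k), ← mul_assoc, ← mul_pow]
      push_cast
      rw [add_sub_cancel_left]
      gcongr
      calc (J : ℝ≥0∞) + k + 1 ≤ J + k + 1 + J * k := le_self_add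
        _ = (J + 1) * (k + 1) := by ring
    · intro j hj
      by_cases h : J ≤ j
      · exact ⟨j - J, Nat.add_sub_cancel' h⟩
      · simp [h] at hj

/-- The number of indices below level `J`. -/
theorem card_le_of_level_lt {e : ℕ} {A : (Fin (e + 1) → ℕ) → Set (Fin (e + 1) → ℤ)} {C : ℕ}
    (hfin : ∀ ν, (A ν).Finite) (hcard : ∀ ν, (A ν).ncard ≤ C * 2 ^ (∑ l, ν l)) (J : ℕ)
    (s : Finset (Σ ν, A ν)) (hs : ∀ i ∈ s, ∑ l, i.1 l < J) :
    (s.card : ℝ≥0∞) ≤ C * (2 ^ J * ((J : ℝ≥0∞) + 1) ^ e) := by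
  have h1 : (s.card : ℝ≥0∞) ≤ ∑' i : Σ ν, A ν, if ∑ l, i.1 l < J then 1 else 0 := by
    refine le_trans ?_ (ENNReal.sum_le_tsum s)
    rw [Finset.sum_congr rfl fun i hi => if_pos (hs i hi)]
    simp
  refine h1.trans ?_
  rw [ENNReal.tsum_sigma']
  have h2 : ∀ ν : Fin (e + 1) → ℕ, ∑' _ : A ν, (if ∑ l, ν l < J then (1 : ℝ≥0∞) else 0) ≤
      (fun j => if j < J then (C : ℝ≥0∞) * 2 ^ j else 0) (∑ l, ν l) := by
    intro ν
    have : Fintype (A ν) := (hfin ν).fintype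
    rw [tsum_fintype]
    by_cases h : ∑ l, ν l < J
    · simp only [h, if_true, Finset.sum_const, Finset.card_univ, nsmul_eq_mul, mul_one]
      rw [← Nat.card_eq_fintype_card, Nat.card_coe_set_eq]
      exact_mod_cast hcard ν
    · simp [h]
  refine ((ENNReal.tsum_le_tsum h2).trans (tsum_sum_coords_le e fun j =>
    if j < J then (C : ℝ≥0∞) * 2 ^ j else 0)).trans ?_
  rw [tsum_eq_sum (s := Finset.range J)]
  · have hg : ∑ j ∈ Finset.range J, (2 : ℝ≥0∞) ^ j ≤ 2 ^ J := by
      have : ∑ j ∈ Finset.range J, 2 ^ j ≤ 2 ^ J := by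
        rw [Nat.geomSum_eq le_rfl]
        simp
      exact_mod_cast this
    calc ∑ j ∈ Finset.range J, ((j : ℝ≥0∞) + 1) ^ e * (if j < J then (C : ℝ≥0∞) * 2 ^ j else 0)
        ≤ ∑ j ∈ Finset.range J, (C * ((J : ℝ≥0∞) + 1) ^ e) * 2 ^ j := by
          refine Finset.sum_le_sum fun j hj => ?_
          have hj' := Finset.mem_range.1 hj
          rw [if_pos hj', mul_comm (C : ℝ≥0∞) ((_) ^ e), mul_assoc]
          gcongr
      _ = (C * ((J : ℝ≥0∞) + 1) ^ e) * ∑ j ∈ Finset.range J, (2 : ℝ≥0∞) ^ j := by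
          rw [Finset.mul_sum]
      _ ≤ (C * ((J : ℝ≥0∞) + 1) ^ e) * 2 ^ J := by gcongr
      _ = C * (2 ^ J * ((J : ℝ≥0∞) + 1) ^ e) := by ring
  · intro j hj
    rw [if_neg (by simpa using hj), mul_zero]

end LevelSums

/-! ### The index sets of the wavelets meeting the cube -/

section CubeIndex

theorem exists_support_radius {ψ : ℝ → ℂ} (h : HasCompactSupport ψ) :
    ∃ R : ℕ, ∀ x, ψ x ≠ 0 → |x| ≤ R := by
  obtain ⟨r, hr⟩ := h.isCompact.isBounded.subset_closedBall 0
  obtain ⟨R, hR⟩ := exists_nat_ge r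
  refine ⟨R, fun x hx => ?_⟩
  have := hr (subset_tsupport ψ hx)
  rw [mem_closedBall_zero_iff, Real.norm_eq_abs] at this
  exact this.trans hR

/-- The entries of the indices in `A_ν^Ω` are between `-R` and `2^ν + R`. -/
theorem exists_cubeIndex_subset {ψ₀ ψ₁ : ℝ → ℂ} (h₀ : HasCompactSupport ψ₀)
    (h₁ : HasCompactSupport ψ₁) : ∃ R : ℕ, ∀ (d : ℕ) (ν : Fin d → ℕ), ∀ m ∈ cubeIndex ψ₀ ψ₁ ν,
      ∀ l, -(R : ℤ) ≤ m l ∧ m l ≤ 2 ^ ν l + R := by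
  obtain ⟨R₀, hR₀⟩ := exists_support_radius h₀
  obtain ⟨R₁, hR₁⟩ := exists_support_radius h₁
  refine ⟨max R₀ R₁, fun d ν m hm l => ?_⟩
  obtain ⟨x, hx, hx01⟩ := hm
  -- `s` is the dilation factor of the wavelet, `1` or `2 ^ (ν l - 1)`. The resulting condition is
  -- closed, so it passes from nonvanishing points to the topological support.
  obtain ⟨s, hs0, hs1, hs⟩ : ∃ s : ℝ, 0 ≤ s ∧ s ≤ 2 ^ ν l ∧
      ∀ y, waveletFn ψ₀ ψ₁ (ν l) (m l) y ≠ 0 → |s * y - m l| ≤ max (R₀ : ℝ) R₁ := by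
    rcases ν l with _ | j
    · refine ⟨1, by simp, by simp, fun y hy => ?_⟩
      rw [one_mul]
      exact (hR₀ _ hy).trans (le_max_left _ _)
    · refine ⟨2 ^ j, by positivity, pow_le_pow_right₀ one_le_two (Nat.le_succ j), fun y hy => ?_⟩
      exact (hR₁ _ (right_ne_zero_of_mul hy)).trans (le_max_right _ _)
  have hcl : IsClosed {y : Fin d → ℝ | |s * y l - m l| ≤ max (R₀ : ℝ) R₁} :=
    isClosed_le (by fun_prop) continuous_const
  have hsub : tsupport (tensorWavelet ψ₀ ψ₁ ν m) ⊆ {y : Fin d → ℝ | |s * y l - m l| ≤ max (R₀ : ℝ) R₁} :=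
    closure_minimal (fun y hy => hs _ (Finset.prod_ne_zero_iff.1 hy l (Finset.mem_univ l))) hcl
  have hx' : |s * x l - m l| ≤ max (R₀ : ℝ) R₁ := hsub hx
  have h := abs_le.1 hx'
  have hxl := hx01 l (mem_univ l)
  have h1 : 0 ≤ s * x l := mul_nonneg hs0 hxl.1.le
  have h2 : s * x l ≤ 2 ^ ν l :=
    (mul_le_of_le_one_right hs0 hxl.2.le).trans hs1
  constructor
  · have : (-(max R₀ R₁ : ℝ)) ≤ (m l : ℝ) := by linarith
    exact_mod_cast this
  · have : (m l : ℝ) ≤ 2 ^ ν l + (max R₀ R₁ : ℝ) := by linarith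
    exact_mod_cast this

theorem exists_cubeIndex_ncard_le {ψ₀ ψ₁ : ℝ → ℂ} (h₀ : HasCompactSupport ψ₀)
    (h₁ : HasCompactSupport ψ₁) (d : ℕ) : ∃ C : ℕ, ∀ ν : Fin d → ℕ,
      (cubeIndex ψ₀ ψ₁ ν).Finite ∧ (cubeIndex ψ₀ ψ₁ ν).ncard ≤ C * 2 ^ (∑ l, ν l) := by
  obtain ⟨R, hR⟩ := exists_cubeIndex_subset h₀ h₁
  refine ⟨(2 * R + 2) ^ d, fun ν => ?_⟩
  have hsub : cubeIndex ψ₀ ψ₁ ν ⊆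
      (Fintype.piFinset fun l => Finset.Icc (-(R : ℤ)) (2 ^ ν l + R) : Finset (Fin d → ℤ)) := by
    intro m hm
    exact Finset.mem_coe.2 (Fintype.mem_piFinset.2 fun l => Finset.mem_Icc.2 (hR d ν m hm l))
  refine ⟨(Finset.finite_toSet _).subset hsub, (ncard_le_ncard hsub (Finset.finite_toSet _)).trans ?_⟩
  rw [ncard_coe_finset, Fintype.card_piFinset, ← Finset.prod_pow_eq_pow_sum]
  calc ∏ l, (Finset.Icc (-(R : ℤ)) (2 ^ ν l + R)).card
      ≤ ∏ l : Fin d, (2 * R + 2) * 2 ^ ν l := by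
        refine Finset.prod_le_prod' fun l _ => ?_
        rw [Int.card_Icc, Int.toNat_le]
        push_cast
        have h2 : (1 : ℤ) ≤ 2 ^ ν l := one_le_pow₀ one_le_two
        nlinarith
    _ = (2 * R + 2) ^ d * ∏ l, 2 ^ ν l := by
        rw [Finset.prod_mul_distrib, Finset.prod_const, Finset.card_univ, Fintype.card_fin]

/-- Confines all integrals to a set of finite measure, where `L_p` norms are controlled by `L_q`
norms for `p ≤ q`. -/
theorem exists_dyadicBox_subset {ψ₀ ψ₁ : ℝ → ℂ} (h₀ : HasCompactSupport ψ₀)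
    (h₁ : HasCompactSupport ψ₁) (d : ℕ) : ∃ B : ℝ, ∀ ν : Fin d → ℕ, ∀ m ∈ cubeIndex ψ₀ ψ₁ ν,
      dyadicBox ν m ⊆ Icc (fun _ => -B) fun _ => B := by
  obtain ⟨R, hR⟩ := exists_cubeIndex_subset h₀ h₁
  refine ⟨R + 2, fun ν m hm x hx => ?_⟩
  have key : ∀ l, -((R : ℝ) + 2) ≤ x l ∧ x l ≤ R + 2 := by
    intro l
    obtain ⟨hm1, hm2⟩ := hR d ν m hm l
    obtain ⟨hx1, hx2⟩ := hx l
    rw [zpow_neg, zpow_natCast] at hx1 hx2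
    have hm1' : -(R : ℝ) ≤ m l := by exact_mod_cast hm1
    have hm2' : (m l : ℝ) ≤ 2 ^ ν l + R := by exact_mod_cast hm2
    have h1 : (1 : ℝ) ≤ 2 ^ ν l := one_le_pow₀ one_le_two
    have h0 : (0 : ℝ) < 2 ^ ν l := by positivity
    have hR0 : (0 : ℝ) ≤ R := Nat.cast_nonneg R
    rw [inv_mul_lt_iff₀ h0] at hx1
    rw [lt_inv_mul_iff₀ h0] at hx2
    constructor
    · by_contra! h
      nlinarith
    · by_contra! h
      nlinarith
  exact ⟨fun l => (key l).1, fun l => (key l).2⟩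

theorem IsWaveletSystem.exists_ne_zero {N : ℕ} {ψ₀ ψ₁ : ℝ → ℂ} (h : IsWaveletSystem N ψ₀ ψ₁) :
    ∃ y, ψ₁ y ≠ 0 := by
  by_contra! h0
  obtain ⟨b, hb⟩ := h.basis
  have h1 : b (1, 0) = 0 := by
    refine (Lp.eq_zero_iff_ae_eq_zero).2 ((hb (1, 0)).trans (Filter.Eventually.of_forall fun x => ?_))
    simp [waveletFn, h0]
  have h2 := b.orthonormal.1 (1, 0)
  rw [h1, norm_zero] at h2
  exact zero_ne_one h2

theorem IsWaveletSystem.infinite_cubeIndex {N : ℕ} {ψ₀ ψ₁ : ℝ → ℂ} (h : IsWaveletSystem N ψ₀ ψ₁)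
    {d : ℕ} (hd : 1 ≤ d) : Infinite (Σ ν : Fin d → ℕ, cubeIndex ψ₀ ψ₁ ν) := by
  obtain ⟨y, hy⟩ := h.exists_ne_zero
  -- Translation by `⌊-y⌋ + 1` moves `y` into `(0, 1]`; level `j + 2` divides by `2 ^ (j + 1) ≥ 2`,
  -- which places the point inside the open cube.
  have hm : ∀ j : ℕ, (fun _ => ⌊-y⌋ + 1) ∈ cubeIndex ψ₀ ψ₁ (fun _ : Fin d => j + 2) := by
    intro j
    have hf1 := Int.floor_le (-y)
    have hf2 := Int.lt_floor_add_one (-y)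
    have h2 : (2 : ℝ) ≤ 2 ^ (j + 1) := by
      rw [pow_succ]
      have : (1 : ℝ) ≤ 2 ^ j := one_le_pow₀ one_le_two
      linarith
    have h0 : (0 : ℝ) < 2 ^ (j + 1) := by positivity
    refine ⟨fun _ => (y + (⌊-y⌋ + 1)) / 2 ^ (j + 1), subset_tsupport _ ?_, fun l _ => ⟨?_, ?_⟩⟩
    · refine Finset.prod_ne_zero_iff.2 fun l _ => ?_
      simp only [waveletFn]
      refine mul_ne_zero ?_ ?_
      · rw [Complex.ofReal_ne_zero, Real.sqrt_ne_zero']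
        norm_num
      · push_cast
        rwa [mul_div_cancel₀ _ h0.ne', add_sub_cancel_right]
    · exact div_pos (by linarith) h0
    · rw [div_lt_one h0]
      linarith
  refine Infinite.of_injective (fun j : ℕ => (⟨_, ⟨_, hm j⟩⟩ : Σ ν, cubeIndex ψ₀ ψ₁ ν)) ?_
  intro j k hjk
  have := congrFun (congrArg Sigma.fst hjk) ⟨0, hd⟩
  simpa using this

end CubeIndex

/-! ### The square function and the quasi-norm of `s^0_{p,2} f` -/

section SequenceSpaces

theorem dyadicBox_eq_pi {d : ℕ} (ν : Fin d → ℕ) (m : Fin d → ℤ) :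
    dyadicBox ν m = univ.pi fun l =>
      Ioo ((2 : ℝ) ^ (-(ν l : ℤ)) * m l) ((2 : ℝ) ^ (-(ν l : ℤ)) * (m l + 1)) := by
  ext x
  simp [dyadicBox]

theorem measurableSet_dyadicBox {d : ℕ} (ν : Fin d → ℕ) (m : Fin d → ℤ) :
    MeasurableSet (dyadicBox ν m) := by
  rw [dyadicBox_eq_pi]
  exact MeasurableSet.univ_pi fun _ => measurableSet_Ioo

theorem volume_dyadicBox {d : ℕ} (ν : Fin d → ℕ) (m : Fin d → ℤ) :
    volume (dyadicBox ν m) = (2 : ℝ≥0∞) ^ (-((∑ l, ν l : ℕ) : ℝ)) := by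
  rw [dyadicBox_eq_pi, Real.volume_pi_Ioo]
  have h : ∀ l, ENNReal.ofReal ((2 : ℝ) ^ (-(ν l : ℤ)) * (m l + 1) - (2 : ℝ) ^ (-(ν l : ℤ)) * m l) =
      (2⁻¹ : ℝ≥0∞) ^ ν l := by
    intro l
    rw [← mul_sub, add_sub_cancel_left, mul_one, zpow_neg, zpow_natCast, ← inv_pow,
      ENNReal.ofReal_pow (by norm_num), ENNReal.ofReal_inv_of_pos two_pos, ENNReal.ofReal_ofNat]
  rw [Finset.prod_congr rfl fun l _ => h l, Finset.prod_pow_eq_pow_sum, ENNReal.rpow_neg,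
    ENNReal.rpow_natCast, ENNReal.inv_pow]

theorem eq_of_mem_dyadicBox {d : ℕ} {ν : Fin d → ℕ} {m m' : Fin d → ℤ} {x : Fin d → ℝ}
    (h : x ∈ dyadicBox ν m) (h' : x ∈ dyadicBox ν m') : m = m' := by
  have key : ∀ m : Fin d → ℤ, x ∈ dyadicBox ν m → ∀ l, ⌊(2 : ℝ) ^ ν l * x l⌋ = m l := by
    intro m hm l
    obtain ⟨h1, h2⟩ := hm l
    have h0 : (0 : ℝ) < 2 ^ ν l := by positivity
    rw [zpow_neg, zpow_natCast] at h1 h2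
    rw [inv_mul_lt_iff₀ h0] at h1
    rw [lt_inv_mul_iff₀ h0] at h2
    exact Int.floor_eq_iff.2 ⟨h1.le, h2⟩
  funext l
  rw [← key m h l, ← key m' h' l]

variable {d : ℕ} {A : (Fin d → ℕ) → Set (Fin d → ℤ)}

/-- The square function of a family. -/
noncomputable def squareFn (u : MixedSeq A) (x : Fin d → ℝ) : ℝ≥0∞ :=
  ∑' i : Σ ν, A ν, (dyadicBox i.1 i.2).indicator (fun _ => ‖u i‖ₑ ^ (2 : ℝ)) x

theorem measurable_squareFn (u : MixedSeq A) : Measurable (squareFn u) :=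
  Measurable.tsum fun _ => measurable_const.indicator (measurableSet_dyadicBox _ _)

theorem mixedNormF_eq (p : ℝ) (u : MixedSeq A) :
    mixedNormF A p 2 0 u = (∫⁻ x, squareFn u x ^ (p / 2)) ^ (1 / p) := by
  have h : ∀ x, (ellNorm 2 fun i : Σ ν, A ν => (dyadicBox i.1 i.2).indicator
      (fun _ => (2 : ℝ≥0∞) ^ (levelSum i.1 * 0) * ‖u i‖ₑ) x) = squareFn u x ^ (1 / 2 : ℝ) := by
    intro x
    rw [ellNorm, if_neg ENNReal.ofNat_ne_top, ENNReal.toReal_ofNat, squareFn]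
    congr 1
    refine tsum_congr fun i => ?_
    by_cases hx : x ∈ dyadicBox i.1 i.2
    · simp [hx]
    · simp [hx]
  rw [mixedNormF]
  simp_rw [h, ← ENNReal.rpow_mul]
  rw [show (1 / 2 : ℝ) * p = p / 2 by ring]

/-- One term of the square function, integrated over its own box, already gives the bound. It makes
coordinates continuous for the quasi-norm. -/
theorem enorm_le_mixedNormF {p : ℝ} (hp : 0 < p) (i : Σ ν, A ν) :
    ∃ C : ℝ≥0∞, C ≠ ∞ ∧ ∀ u : MixedSeq A, ‖u i‖ₑ ≤ C * mixedNormF A p 2 0 u := by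
  set v := volume (dyadicBox i.1 (i.2 : Fin d → ℤ)) with hv
  have hv0 : v ≠ 0 := by
    rw [hv, volume_dyadicBox]
    exact (ENNReal.rpow_pos (by norm_num) (by norm_num)).ne'
  have hvt : v ≠ ∞ := by
    rw [hv, volume_dyadicBox]
    exact ENNReal.rpow_ne_top_of_ne_zero (by norm_num) (by norm_num)
  have hw0 : v ^ (1 / p) ≠ 0 := (ENNReal.rpow_pos (pos_iff_ne_zero.2 hv0) hvt).ne'
  have hwt : v ^ (1 / p) ≠ ∞ := ENNReal.rpow_ne_top_of_ne_zero hv0 hvt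
  refine ⟨(v ^ (1 / p))⁻¹, ENNReal.inv_ne_top.2 hw0, fun u => ?_⟩
  rw [mul_comm, ← div_eq_mul_inv, ENNReal.le_div_iff_mul_le (Or.inl hw0) (Or.inl hwt),
    mixedNormF_eq]
  calc ‖u i‖ₑ * v ^ (1 / p)
      = (∫⁻ x, (dyadicBox i.1 (i.2 : Fin d → ℤ)).indicator (fun _ => ‖u i‖ₑ ^ p) x) ^ (1 / p) := by
        rw [lintegral_indicator (measurableSet_dyadicBox _ _), setLIntegral_const,
          ENNReal.mul_rpow_of_nonneg _ _ (by positivity), ← ENNReal.rpow_mul,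
          mul_one_div_cancel hp.ne', ENNReal.rpow_one]
    _ ≤ _ := by
        refine ENNReal.rpow_le_rpow (lintegral_mono fun x => ?_) (by positivity)
        by_cases hx : x ∈ dyadicBox i.1 (i.2 : Fin d → ℤ)
        · rw [indicator_of_mem hx]
          have h := ENNReal.le_tsum (f := fun i : Σ ν, A ν =>
            (dyadicBox i.1 i.2).indicator (fun _ => ‖u i‖ₑ ^ (2 : ℝ)) x) i
          simp only [indicator_of_mem hx] at h
          refine le_trans (le_of_eq ?_) (ENNReal.rpow_le_rpow h (by positivity))
          rw [← ENNReal.rpow_mul]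
          congr 1
          ring
        · rw [indicator_of_notMem hx]
          exact zero_le

theorem squareFn_eq_zero {B : ℝ} (hB : ∀ ν, ∀ m ∈ A ν, dyadicBox ν m ⊆ Icc (fun _ => -B) fun _ => B)
    (u : MixedSeq A) {x : Fin d → ℝ} (hx : x ∉ Icc (fun _ : Fin d => -B) fun _ => B) :
    squareFn u x = 0 :=
  ENNReal.tsum_eq_zero.2 fun i => indicator_of_notMem (fun h => hx (hB i.1 i.2 i.2.2 h)) _

theorem mixedNormF_eq_setLIntegral {B : ℝ}
    (hB : ∀ ν, ∀ m ∈ A ν, dyadicBox ν m ⊆ Icc (fun _ => -B) fun _ => B) {p : ℝ} (hp : 0 < p)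
    (u : MixedSeq A) : mixedNormF A p 2 0 u =
      (∫⁻ x in Icc (fun _ => -B) fun _ => B, squareFn u x ^ (p / 2)) ^ (1 / p) := by
  rw [mixedNormF_eq, ← lintegral_indicator measurableSet_Icc]
  congr 2
  funext x
  by_cases hx : x ∈ Icc (fun _ : Fin d => -B) fun _ => B
  · rw [indicator_of_mem hx]
  · rw [indicator_of_notMem hx, squareFn_eq_zero hB u hx, ENNReal.zero_rpow_of_pos (by positivity)]

theorem mixedNormF_le_of_finite {B : ℝ}
    (hB : ∀ ν, ∀ m ∈ A ν, dyadicBox ν m ⊆ Icc (fun _ => -B) fun _ => B) {p : ℝ} (hp : 0 < p)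
    (I : Finset (Σ ν, A ν)) : ∃ C : ℝ≥0∞, C ≠ ∞ ∧ ∀ u : MixedSeq A, (∀ i ∉ I, u i = 0) →
      ∀ η : ℝ≥0∞, (∀ i, ‖u i‖ₑ ≤ η) → mixedNormF A p 2 0 u ≤ C * η := by
  have hvol : volume (Icc (fun _ : Fin d => -B) fun _ => B) ≠ ∞ := isCompact_Icc.measure_ne_top
  refine ⟨(I.card : ℝ≥0∞) ^ (1 / 2 : ℝ) * volume (Icc (fun _ : Fin d => -B) fun _ => B) ^ (1 / p),
    ENNReal.mul_ne_top (ENNReal.rpow_ne_top_of_nonneg (by positivity) (ENNReal.natCast_ne_top _))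
      (ENNReal.rpow_ne_top_of_nonneg (by positivity) hvol), fun u hu η hη => ?_⟩
  have hS : ∀ x, squareFn u x ≤ I.card * η ^ (2 : ℝ) := by
    intro x
    rw [squareFn, tsum_eq_sum (s := I), ← nsmul_eq_mul]
    · refine Finset.sum_le_card_nsmul _ _ _ fun i _ => ?_
      refine (indicator_le_self' (fun _ _ => zero_le) x).trans ?_
      exact ENNReal.rpow_le_rpow (hη i) (by positivity)
    · intro i hi
      simp [hu i hi]
  rw [mixedNormF_eq_setLIntegral hB hp]
  calc (∫⁻ x in Icc (fun _ => -B) fun _ => B, squareFn u x ^ (p / 2)) ^ (1 / p)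
      ≤ (∫⁻ _ in Icc (fun _ : Fin d => -B) fun _ => B,
          ((I.card : ℝ≥0∞) * η ^ (2 : ℝ)) ^ (p / 2)) ^ (1 / p) := by
        refine ENNReal.rpow_le_rpow (lintegral_mono fun x => ?_) (by positivity)
        exact ENNReal.rpow_le_rpow (hS x) (by positivity)
    _ = _ := by
        rw [setLIntegral_const, ENNReal.mul_rpow_of_nonneg _ _ (by positivity : 0 ≤ 1 / p),
          ← ENNReal.rpow_mul, show p / 2 * (1 / p) = 1 / 2 by field_simp,
          ENNReal.mul_rpow_of_nonneg _ _ (by positivity : (0 : ℝ) ≤ 1 / 2), ← ENNReal.rpow_mul,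
          mul_one_div_cancel two_ne_zero, ENNReal.rpow_one]
        ring

/-- Boxes with the same `ν` are pairwise disjoint, so at most one term survives. -/
theorem tsum_indicator_dyadicBox_le (ν : Fin d → ℕ) (c : ℝ≥0∞) (x : Fin d → ℝ) :
    ∑' m : A ν, (dyadicBox ν m).indicator (fun _ => c) x ≤ c := by
  by_cases h : ∃ m : A ν, x ∈ dyadicBox ν m
  · obtain ⟨m, hm⟩ := h
    rw [tsum_eq_single m]
    · exact indicator_le_self' (fun _ _ => zero_le) x
    · intro m' hm'
      exact indicator_of_notMem (fun h' => hm' (Subtype.ext (eq_of_mem_dyadicBox h' hm))) _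
  · push Not at h
    simp [indicator_of_notMem (h _)]

theorem tsum_mul_le_weight_mul_Lp {ι : Type*} {r : ℝ} (hr : 1 ≤ r) (w f : ι → ℝ≥0∞) :
    ∑' i, w i * f i ≤ (∑' i, w i) ^ (1 - r⁻¹) * (∑' i, w i * f i ^ r) ^ r⁻¹ := by
  rw [ENNReal.tsum_eq_iSup_sum]
  refine iSup_le fun s => (ENNReal.inner_le_weight_mul_Lp_of_nonneg s hr w f).trans ?_
  have h : 0 ≤ 1 - r⁻¹ := sub_nonneg.2 (inv_le_one_of_one_le₀ hr)
  gcongr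
  · exact ENNReal.sum_le_tsum s
  · exact ENNReal.sum_le_tsum s

end SequenceSpaces

/-! ### Quasi-norm of families supported on high levels -/

section HighLevels

variable {e : ℕ} {A : (Fin (e + 1) → ℕ) → Set (Fin (e + 1) → ℤ)}

/-- Families supported on levels above `J`: the integral of a power of the square function is
controlled by a weighted `ℓ_q` norm of the coefficients. -/
theorem exists_lintegral_squareFn_le {r ε : ℝ} (hr : 1 ≤ r) (hε : 0 < ε) :
    ∃ C : ℝ≥0∞, C ≠ ∞ ∧ ∀ (J : ℕ) (u : MixedSeq A), (∀ i, ∑ l, i.1 l < J → u i = 0) →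
      ∫⁻ x, squareFn u x ^ r ≤ (C * ((J : ℝ≥0∞) + 1) ^ e) ^ (r - 1) *
        ∑' i, (2 : ℝ≥0∞) ^ (ε * (((∑ l, i.1 l : ℕ) : ℝ) - J) - ((∑ l, i.1 l : ℕ) : ℝ)) *
          ‖u i‖ₑ ^ (2 * r) := by
  have hr0 : 0 < r := one_pos.trans_le hr
  obtain ⟨C, hC, hsum⟩ := exists_tsum_level_weight_le e (div_pos hε hr0)
  refine ⟨C, hC, fun J u hu => ?_⟩
  set δ := ε / r with hδ
  have hδ0 : 0 < δ := div_pos hε hr0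
  -- Each `‖u i‖ₑ ^ 2` is factored as `w * f`. Hölder's inequality with weight `w` costs the power
  -- `r - 1` of the total weight at `x`, which is at most `C * (J + 1) ^ e`.
  set w : (Fin (e + 1) → ℕ) → ℝ≥0∞ := fun ν => if J ≤ ∑ l, ν l then
    (2 : ℝ≥0∞) ^ (-(δ * (((∑ l, ν l : ℕ) : ℝ) - J))) else 0 with hw
  set f : (Σ ν, A ν) → ℝ≥0∞ := fun i =>
    (2 : ℝ≥0∞) ^ (δ * (((∑ l, i.1 l : ℕ) : ℝ) - J)) * ‖u i‖ₑ ^ (2 : ℝ) with hf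
  have h2 : (2 : ℝ≥0∞) ≠ 0 := two_ne_zero
  have h2t : (2 : ℝ≥0∞) ≠ ∞ := ENNReal.ofNat_ne_top
  have hpt : ∀ x, squareFn u x ^ r ≤ (C * ((J : ℝ≥0∞) + 1) ^ e) ^ (r - 1) *
      ∑' i : Σ ν, A ν, (dyadicBox i.1 i.2).indicator (fun _ => w i.1 * f i ^ r) x := by
    intro x
    have h1 : squareFn u x ≤
        ∑' i : Σ ν, A ν, (dyadicBox i.1 i.2).indicator (fun _ => w i.1) x * f i := by
      refine ENNReal.tsum_le_tsum fun i => ?_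
      by_cases hx : x ∈ dyadicBox i.1 (i.2 : Fin (e + 1) → ℤ)
      · rw [indicator_of_mem hx, indicator_of_mem hx]
        by_cases hi : J ≤ ∑ l, i.1 l
        · simp only [hw, hf, if_pos hi]
          rw [← mul_assoc, ← ENNReal.rpow_add _ _ h2 h2t, neg_add_cancel, ENNReal.rpow_zero,
            one_mul]
        · rw [hu i (not_le.1 hi), enorm_zero, ENNReal.zero_rpow_of_pos two_pos]
          exact zero_le
      · simp [indicator_of_notMem hx]
    have h3 : ∑' i : Σ ν, A ν, (dyadicBox i.1 i.2).indicator (fun _ => w i.1) x ≤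
        C * ((J : ℝ≥0∞) + 1) ^ e := by
      rw [ENNReal.tsum_sigma']
      exact (ENNReal.tsum_le_tsum fun ν => tsum_indicator_dyadicBox_le ν (w ν) x).trans (hsum J)
    have h4 := ENNReal.rpow_le_rpow (h1.trans (tsum_mul_le_weight_mul_Lp hr _ _)) hr0.le
    rw [ENNReal.mul_rpow_of_nonneg _ _ hr0.le, ← ENNReal.rpow_mul, ← ENNReal.rpow_mul,
      inv_mul_cancel₀ hr0.ne', ENNReal.rpow_one, sub_mul, one_mul, inv_mul_cancel₀ hr0.ne'] at h4
    refine h4.trans ?_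
    have hr1 : 0 ≤ r - 1 := sub_nonneg.2 hr
    gcongr with i
    by_cases hx : x ∈ dyadicBox i.1 (i.2 : Fin (e + 1) → ℤ)
    · simp [indicator_of_mem hx]
    · simp [indicator_of_notMem hx]
  refine (lintegral_mono hpt).trans ?_
  rw [lintegral_const_mul _ (Measurable.tsum fun _ =>
      measurable_const.indicator (measurableSet_dyadicBox _ _)),
    lintegral_tsum fun i => (measurable_const.indicator (measurableSet_dyadicBox _ _)).aemeasurable]
  gcongr with i
  rw [lintegral_indicator (measurableSet_dyadicBox _ _), setLIntegral_const, volume_dyadicBox]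
  by_cases hi : J ≤ ∑ l, i.1 l
  · simp only [hw, hf, if_pos hi]
    rw [ENNReal.mul_rpow_of_nonneg _ _ hr0.le, ← ENNReal.rpow_mul, ← ENNReal.rpow_mul, ← mul_assoc,
      ← ENNReal.rpow_add _ _ h2 h2t, mul_right_comm, ← ENNReal.rpow_add _ _ h2 h2t]
    gcongr
    · exact one_le_two
    · have hJ : (0 : ℝ) ≤ ((∑ l, i.1 l : ℕ) : ℝ) - J := sub_nonneg.2 (by exact_mod_cast hi)
      have hδr : δ * r = ε := div_mul_cancel₀ _ hr0.ne'
      -- The exponent of `w * f ^ r` is `δ * (r - 1)` times the distance to level `J`, which is at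
      -- most `ε` times it.
      nlinarith [mul_nonneg hδ0.le hJ]
  · simp only [hw, if_neg hi, zero_mul]
    exact zero_le

/-- Hölder's inequality on the bounded cube passes from `L_p` to `L_q`; the square function estimate
with `r = q / 2 ≥ 1` does the rest. -/
theorem exists_mixedNormF_le {B : ℝ}
    (hB : ∀ ν, ∀ m ∈ A ν, dyadicBox ν m ⊆ Icc (fun _ => -B) fun _ => B)
    {p q ε : ℝ} (hp : 0 < p) (hpq : p ≤ q) (hq : 2 ≤ q) (hε : 0 < ε) :
    ∃ C : ℝ≥0∞, C ≠ ∞ ∧ ∀ (J : ℕ) (u : MixedSeq A), (∀ i, ∑ l, i.1 l < J → u i = 0) →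
      mixedNormF A p 2 0 u ≤ C * ((J : ℝ≥0∞) + 1) ^ ((e : ℝ) * (1 / 2 - 1 / q)) *
        (∑' i, (2 : ℝ≥0∞) ^ (ε * (((∑ l, i.1 l : ℕ) : ℝ) - J) - ((∑ l, i.1 l : ℕ) : ℝ)) *
          ‖u i‖ₑ ^ q) ^ (1 / q) := by
  have hq0 : 0 < q := hp.trans_le hpq
  obtain ⟨C, hC, h⟩ := exists_lintegral_squareFn_le (A := A) (r := q / 2) (by linarith) hε
  set D := Icc (fun _ : Fin (e + 1) => -B) fun _ => B
  have hvol : volume D ≠ ∞ := isCompact_Icc.measure_ne_top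
  have hpq' : 0 ≤ 1 / p - 1 / q := sub_nonneg.2 (one_div_le_one_div_of_le hp hpq)
  have hq2 : 0 ≤ 1 / 2 - 1 / q := sub_nonneg.2 (one_div_le_one_div_of_le two_pos hq)
  refine ⟨C ^ (1 / 2 - 1 / q) * volume D ^ (1 / p - 1 / q), ENNReal.mul_ne_top
    (ENNReal.rpow_ne_top_of_nonneg hq2 hC) (ENNReal.rpow_ne_top_of_nonneg hpq' hvol),
    fun J u hu => ?_⟩
  have h1 := eLpNorm'_le_eLpNorm'_mul_rpow_measure_univ (μ := volume.restrict D)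
    (f := fun x => squareFn u x ^ (1 / 2 : ℝ)) hp hpq
    ((measurable_squareFn u).pow_const _).aestronglyMeasurable
  simp only [eLpNorm', enorm_eq_self, ← ENNReal.rpow_mul, Measure.restrict_apply_univ] at h1
  rw [show 1 / 2 * p = p / 2 by ring, show 1 / 2 * q = q / 2 by ring] at h1
  rw [mixedNormF_eq_setLIntegral hB hp]
  refine h1.trans ?_
  have h2 := ENNReal.rpow_le_rpow ((setLIntegral_le_lintegral D _).trans (h J u hu))
    (by positivity : 0 ≤ 1 / q)
  rw [mul_div_cancel₀ _ (two_ne_zero' ℝ), ENNReal.mul_rpow_of_nonneg _ _ (by positivity),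
    ← ENNReal.rpow_mul, show (q / 2 - 1) * (1 / q) = 1 / 2 - 1 / q by field_simp,
    ENNReal.mul_rpow_of_nonneg _ _ hq2, ← ENNReal.rpow_natCast _ e, ← ENNReal.rpow_mul] at h2
  refine (mul_le_mul_left h2 _).trans (le_of_eq ?_)
  ring

end HighLevels

/-! ### Coefficient bounds in the unit ball of `s^t_{p,p} b` -/

section Balls

theorem le_ellNorm {ι : Type*} {p : ℝ≥0∞} (hp : 0 < p) (u : ι → ℝ≥0∞) (i : ι) :
    u i ≤ ellNorm p u := by
  rw [ellNorm]
  split_ifs with h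
  · exact le_iSup u i
  · have hp' : 0 < p.toReal := ENNReal.toReal_pos hp.ne' h
    calc u i = (u i ^ p.toReal) ^ (1 / p.toReal) := by
          rw [← ENNReal.rpow_mul, mul_one_div_cancel hp'.ne', ENNReal.rpow_one]
      _ ≤ _ := ENNReal.rpow_le_rpow (ENNReal.le_tsum i) (by positivity)

theorem levelSum_eq {d : ℕ} (ν : Fin d → ℕ) : levelSum ν = ((∑ l, ν l : ℕ) : ℝ) := by
  simp [levelSum]

theorem two_rpow_add (a b : ℝ) : (2 : ℝ≥0∞) ^ (a + b) = 2 ^ a * 2 ^ b :=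
  ENNReal.rpow_add _ _ two_ne_zero ENNReal.ofNat_ne_top

theorem two_rpow_ne_top (a : ℝ) : (2 : ℝ≥0∞) ^ a ≠ ∞ :=
  ENNReal.rpow_ne_top_of_ne_zero two_ne_zero ENNReal.ofNat_ne_top

theorem ofReal_two_rpow (a : ℝ) : ENNReal.ofReal ((2 : ℝ) ^ a) = 2 ^ a := by
  rw [← ENNReal.ofReal_rpow_of_pos two_pos, ENNReal.ofReal_ofNat]

variable {d : ℕ} {A : (Fin d → ℕ) → Set (Fin d → ℤ)} {p : ℝ≥0∞} {t : ℝ}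

theorem enorm_le_of_mem_mixedBallB (hp : 0 < p) {u : MixedSeq A} (hu : u ∈ mixedBallB A p p t)
    (i : Σ ν, A ν) : ‖u i‖ₑ ≤ 2 ^ (-(((∑ l, i.1 l : ℕ) : ℝ) * (t - p⁻¹.toReal))) := by
  have h1 : (2 : ℝ≥0∞) ^ (levelSum i.1 * (t - p⁻¹.toReal)) * ‖u i‖ₑ ≤ 1 := by
    refine le_trans ?_ ((le_ellNorm hp _ i.1).trans hu)
    gcongr
    exact le_ellNorm hp (fun m : A i.1 => ‖u ⟨i.1, m⟩‖ₑ) i.2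
  rw [levelSum_eq] at h1
  calc ‖u i‖ₑ = 2 ^ (-(((∑ l, i.1 l : ℕ) : ℝ) * (t - p⁻¹.toReal))) *
        (2 ^ (((∑ l, i.1 l : ℕ) : ℝ) * (t - p⁻¹.toReal)) * ‖u i‖ₑ) := by
        rw [← mul_assoc, ← two_rpow_add, neg_add_cancel, ENNReal.rpow_zero, one_mul]
    _ ≤ _ := mul_le_of_le_one_right' h1

theorem tsum_le_of_mem_mixedBallB (hp : 0 < p) (hpt : p ≠ ∞) {u : MixedSeq A}
    (hu : u ∈ mixedBallB A p p t) :
    ∑' i : Σ ν, A ν, (2 : ℝ≥0∞) ^ (((∑ l, i.1 l : ℕ) : ℝ) * (t - 1 / p.toReal) * p.toReal) *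
      ‖u i‖ₑ ^ p.toReal ≤ 1 := by
  have hp' : 0 < p.toReal := ENNReal.toReal_pos hp.ne' hpt
  have h1 : mixedNormB A p p t u ≤ 1 := hu
  rw [mixedNormB, ellNorm, if_neg hpt] at h1
  have h2 := ENNReal.rpow_le_rpow h1 hp'.le
  rw [← ENNReal.rpow_mul, one_div_mul_cancel hp'.ne', ENNReal.rpow_one, ENNReal.one_rpow] at h2
  refine le_trans (le_of_eq ?_) h2
  rw [ENNReal.tsum_sigma']
  refine tsum_congr fun ν => ?_
  rw [ENNReal.mul_rpow_of_nonneg _ _ hp'.le, ellNorm, if_neg hpt, ← ENNReal.rpow_mul,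
    ← ENNReal.rpow_mul, one_div_mul_cancel hp'.ne', ENNReal.rpow_one, ← ENNReal.tsum_mul_left,
    levelSum_eq, ENNReal.toReal_inv, one_div]

end Balls

/-! ### Soft thresholding -/

section Thresholding

/-- Continuous shrinkage of a complex number by the threshold `θ`. -/
noncomputable def softThreshold (θ : ℝ) (z : ℂ) : ℂ := z - ((θ / max ‖z‖ θ : ℝ) : ℂ) * z

theorem continuous_softThreshold {θ : ℝ} (hθ : 0 < θ) : Continuous (softThreshold θ) := by
  refine continuous_id.sub ((Complex.continuous_ofReal.comp ?_).mul continuous_id)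
  exact continuous_const.div (continuous_norm.max continuous_const) fun z =>
    (hθ.trans_le (le_max_right _ _)).ne'

theorem softThreshold_eq_zero {θ : ℝ} (hθ : 0 < θ) {z : ℂ} (hz : ‖z‖ ≤ θ) :
    softThreshold θ z = 0 := by
  rw [softThreshold, max_eq_right hz, div_self hθ.ne']
  simp

/-- The residual is the radial projection of `z` onto the disc of radius `θ`. -/
theorem norm_sub_softThreshold_le {θ : ℝ} (hθ : 0 < θ) (z : ℂ) :
    ‖z - softThreshold θ z‖ ≤ ‖z‖ ∧ ‖z - softThreshold θ z‖ ≤ θ := by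
  have h0 : 0 < max ‖z‖ θ := hθ.trans_le (le_max_right _ _)
  rw [softThreshold, sub_sub_cancel, norm_mul, Complex.norm_real,
    Real.norm_of_nonneg (by positivity)]
  constructor
  · exact mul_le_of_le_one_left (norm_nonneg _) ((div_le_one h0).2 (le_max_right _ _))
  · rw [div_mul_eq_mul_div, div_le_iff₀ h0]
    gcongr
    exact le_max_left _ _

end Thresholding

/-! ### Error and sparsity of level-dependent thresholding -/

section Approximation

variable {e : ℕ} {A : (Fin (e + 1) → ℕ) → Set (Fin (e + 1) → ℤ)}

/-- The weighted `ℓ_q` functional controlling families on levels above `J`. -/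
noncomputable def levelFunctional (ε q : ℝ) (J : ℕ) (u : MixedSeq A) : ℝ≥0∞ :=
  ∑' i, (2 : ℝ≥0∞) ^ (ε * (((∑ l, i.1 l : ℕ) : ℝ) - J) - ((∑ l, i.1 l : ℕ) : ℝ)) * ‖u i‖ₑ ^ q

/-- Convexity of the `q`-th power. It is used in place of a quasi-triangle inequality for the
`f`-quasi-norm. -/
theorem levelFunctional_sub_le {ε q : ℝ} (hq : 1 ≤ q) (J : ℕ) (u v : MixedSeq A) :
    levelFunctional ε q J (u - v) ≤
      2 ^ (q - 1) * (levelFunctional ε q J u + levelFunctional ε q J v) := by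
  rw [levelFunctional, levelFunctional, levelFunctional, ← ENNReal.tsum_add,
    ← ENNReal.tsum_mul_left]
  refine ENNReal.tsum_le_tsum fun i => ?_
  rw [← mul_add, mul_left_comm]
  gcongr
  refine (ENNReal.rpow_le_rpow ?_ (by linarith)).trans
    (ENNReal.rpow_add_le_mul_rpow_add_rpow _ _ hq)
  exact enorm_sub_le

/-- Error bounds for a coordinatewise approximation that is exact below level `J`. -/
theorem exists_error_le {B : ℝ}
    (hB : ∀ ν, ∀ m ∈ A ν, dyadicBox ν m ⊆ Icc (fun _ => -B) fun _ => B)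
    {p q ε : ℝ} (hp : 0 < p) (hpq : p ≤ q) (hq : 2 ≤ q) (hε : 0 < ε) :
    ∃ C : ℝ≥0∞, C ≠ ∞ ∧ ∀ (J : ℕ) (K : Set (MixedSeq A)) (T : (Σ ν, A ν) → ℂ → ℂ) (D : ℝ≥0∞),
      (∀ i, ∑ l, i.1 l < J → ∀ z, T i z = z) →
      (∀ u ∈ K, levelFunctional ε q J (u - fun i => T i (u i)) ≤ D) →
      (∀ u ∈ K, mixedNormF A p 2 0 (u - fun i => T i (u i)) ≤
        C * (((J : ℝ≥0∞) + 1) ^ ((e : ℝ) * (1 / 2 - 1 / q)) * D ^ (1 / q))) ∧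
      ∀ u ∈ K, ∀ v ∈ K, (∀ i, T i (u i) = T i (v i)) → mixedNormF A p 2 0 (u - v) ≤
        C * (((J : ℝ≥0∞) + 1) ^ ((e : ℝ) * (1 / 2 - 1 / q)) * D ^ (1 / q)) := by
  obtain ⟨C, hC, h⟩ := exists_mixedNormF_le (A := A) hB hp hpq hq hε
  have hq0 : 0 < q := hp.trans_le hpq
  refine ⟨2 * C, ENNReal.mul_ne_top ENNReal.ofNat_ne_top hC, fun J K T D hT hD => ⟨?_, ?_⟩⟩
  · intro u hu
    refine (h J _ fun i hi => by simp [hT i hi]).trans ?_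
    rw [mul_assoc, mul_assoc 2 C]
    refine le_trans ?_ (le_mul_of_one_le_left' one_le_two)
    gcongr
    exact hD u hu
  · intro u hu v hv huv
    have h1 : u - v = (u - fun i => T i (u i)) - (v - fun i => T i (v i)) := by
      funext i
      simp [huv i]
    refine (h J _ fun i hi => ?_).trans ?_
    · have := huv i
      rw [hT i hi, hT i hi] at this
      simp [this]
    have h2 : levelFunctional ε q J (u - v) ≤ 2 ^ q * D := by
      rw [h1]
      refine (levelFunctional_sub_le (by linarith) J _ _).trans ?_
      calc (2 : ℝ≥0∞) ^ (q - 1) * (levelFunctional ε q J (u - fun i => T i (u i)) +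
            levelFunctional ε q J (v - fun i => T i (v i)))
          ≤ 2 ^ (q - 1) * (D + D) := by
            gcongr
            · exact hD u hu
            · exact hD v hv
        _ = 2 ^ (q - 1 + 1) * D := by
            rw [two_rpow_add, ENNReal.rpow_one]
            ring
        _ = 2 ^ q * D := by rw [sub_add_cancel]
    have h3 := ENNReal.rpow_le_rpow h2 (by positivity : 0 ≤ 1 / q)
    rw [ENNReal.mul_rpow_of_nonneg _ _ (by positivity), ← ENNReal.rpow_mul,
      mul_one_div_cancel hq0.ne', ENNReal.rpow_one] at h3
    refine (mul_le_mul_right h3 _).trans (le_of_eq ?_)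
    ring

theorem finite_level_lt (hfin : ∀ ν, (A ν).Finite) (j : ℕ) :
    {i : Σ ν, A ν | ∑ l, i.1 l < j}.Finite := by
  have h1 : {ν : Fin (e + 1) → ℕ | ∑ l, ν l < j}.Finite := by
    refine (Finite.pi' (fun _ : Fin (e + 1) => finite_Iio j)).subset fun ν hν l => ?_
    exact (Finset.single_le_sum (fun _ _ => Nat.zero_le _) (Finset.mem_univ l)).trans_lt hν
  have h2 := h1.biUnion (t := fun ν => Sigma.mk ν '' (univ : Set (A ν))) fun ν _ => by
    have : Finite (A ν) := hfin ν
    exact finite_univ.image _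
  refine h2.subset ?_
  rintro ⟨ν, m⟩ hi
  exact mem_biUnion (x := ν) hi ⟨m, mem_univ _, rfl⟩

/-- Level-dependent thresholding with at most `2 ^ s` nonzero coefficients above level `J`. -/
theorem exists_threshold_approximation (hfin : ∀ ν, (A ν).Finite) {p₁ : ℝ≥0∞} (hp₁ : 0 < p₁)
    (hp₁t : p₁ ≠ ∞) {t q ε δ : ℝ} (hq : p₁.toReal ≤ q) (hδ : 0 < δ)
    (hα : ε + δ * (q - p₁.toReal) / p₁.toReal ≤ q * (t - 1 / p₁.toReal) + 1) (J : ℕ) (s : ℝ) :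
    ∃ (I : Finset (Σ ν, A ν)) (T : (Σ ν, A ν) → ℂ → ℂ), (∀ i, Continuous (T i)) ∧
      (∀ i ∉ I, ∀ z, T i z = 0) ∧ (∀ i, ∑ l, i.1 l < J → ∀ z, T i z = z) ∧
      (∀ u ∈ mixedBallB A p₁ p₁ t, ∀ S : Finset (Σ ν, A ν),
        (∀ i ∈ S, J ≤ ∑ l, i.1 l ∧ T i (u i) ≠ 0) → (S.card : ℝ≥0∞) ≤ 2 ^ s) ∧
      ∀ u ∈ mixedBallB A p₁ p₁ t, levelFunctional ε q J (u - fun i => T i (u i)) ≤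
        2 ^ (-(s * (q - p₁.toReal) / p₁.toReal) - J * (q * (t - 1 / p₁.toReal) + 1)) := by
  classical
  set p := p₁.toReal with hp
  have hp0 : 0 < p := ENNReal.toReal_pos hp₁.ne' hp₁t
  have hq0 : 0 < q := hp0.trans_le hq
  have hinv : p₁⁻¹.toReal = 1 / p := by rw [ENNReal.toReal_inv, one_div]
  -- From level `j₁` on the threshold exceeds every coefficient of the ball. Replacing `T i` by zero
  -- there changes no estimate and leaves finitely many active coordinates.
  obtain ⟨j₁, hj₁⟩ := exists_nat_ge (J + s / δ)
  set x : ℕ → ℝ := fun j => -(j * (t - 1 / p)) + δ * (j - J) / p - s / p with hx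
  set lv : (Σ ν, A ν) → ℕ := fun i => ∑ l, i.1 l with hlv
  set T : (Σ ν, A ν) → ℂ → ℂ := fun i => if lv i < J then id else
    if lv i < j₁ then softThreshold (2 ^ x (lv i)) else fun _ => 0 with hT
  have hθ : ∀ j, (0 : ℝ) < 2 ^ x j := fun j => Real.rpow_pos_of_pos two_pos _
  have hTlow : ∀ i, lv i < J → ∀ z, T i z = z := by
    intro i hi z
    simp [hT, hi]
  have hen : ∀ (z : ℂ) (a : ℝ), ‖z‖ₑ ≤ 2 ^ a ↔ ‖z‖ ≤ 2 ^ a := by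
    intro z a
    rw [← ofReal_two_rpow, ← ofReal_norm,
      ENNReal.ofReal_le_ofReal_iff (Real.rpow_pos_of_pos two_pos _).le]
  have hbig : ∀ u ∈ mixedBallB A p₁ p₁ t, ∀ i, j₁ ≤ lv i → ‖u i‖ ≤ 2 ^ x (lv i) := by
    intro u hu i hi
    have h1 := enorm_le_of_mem_mixedBallB hp₁ hu i
    rw [hinv, hen] at h1
    refine h1.trans (Real.rpow_le_rpow_of_exponent_le one_le_two ?_)
    have h2 : (j₁ : ℝ) ≤ lv i := by exact_mod_cast hi
    have h3 : s / δ ≤ lv i - J := by linarith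
    rw [div_le_iff₀ hδ] at h3
    have h4 : s / p ≤ δ * (lv i - J) / p := by
      gcongr
      linarith
    simp only [hx, hlv] at h4 ⊢
    linarith
  have hThigh : ∀ u ∈ mixedBallB A p₁ p₁ t, ∀ i, J ≤ lv i →
      ‖u i - T i (u i)‖ ≤ ‖u i‖ ∧ ‖u i - T i (u i)‖ ≤ 2 ^ x (lv i) ∧
        (T i (u i) ≠ 0 → 2 ^ x (lv i) ≤ ‖u i‖) := by
    intro u hu i hi
    by_cases h1 : lv i < j₁
    · have h2 : T i (u i) = softThreshold (2 ^ x (lv i)) (u i) := by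
        simp [hT, not_lt.2 hi, h1]
      rw [h2]
      refine ⟨(norm_sub_softThreshold_le (hθ _) _).1, (norm_sub_softThreshold_le (hθ _) _).2,
        fun h => ?_⟩
      by_contra! h3
      exact h (softThreshold_eq_zero (hθ _) h3.le)
    · have h2 : T i (u i) = 0 := by simp [hT, not_lt.2 hi, h1]
      rw [h2, sub_zero]
      exact ⟨le_rfl, hbig u hu i (not_lt.1 h1), fun h => absurd rfl h⟩
  have hfinI : {i : Σ ν, A ν | ∑ l, i.1 l < max J j₁}.Finite := finite_level_lt hfin _
  refine ⟨hfinI.toFinset, T, ?_, ?_, hTlow, ?_, ?_⟩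
  · intro i
    simp only [hT]
    split_ifs
    · exact continuous_id
    · exact continuous_softThreshold (hθ _)
    · exact continuous_const
  · intro i hi z
    have h1 : max J j₁ ≤ lv i := by simpa [hlv] using hi
    have h2 := (le_max_left _ _).trans h1
    have h3 := (le_max_right _ _).trans h1
    simp [hT, not_lt.2 h2, not_lt.2 h3]
  · intro u hu S hS
    calc (S.card : ℝ≥0∞) = ∑ _i ∈ S, 1 := by simp
      -- Chebyshev's argument: every surviving coefficient uses at least `2 ^ (-s)` of the total
      -- budget `1`.
      _ ≤ ∑ i ∈ S, 2 ^ s * ((2 : ℝ≥0∞) ^ ((lv i : ℝ) * (t - 1 / p) * p) * ‖u i‖ₑ ^ p) := by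
          refine Finset.sum_le_sum fun i hi => ?_
          obtain ⟨hJ, hne⟩ := hS i hi
          have h1 := (hThigh u hu i hJ).2.2 hne
          have h2 : (2 : ℝ≥0∞) ^ x (lv i) ≤ ‖u i‖ₑ := by
            rw [← ofReal_two_rpow, ← ofReal_norm]
            exact ENNReal.ofReal_le_ofReal h1
          have h3 := ENNReal.rpow_le_rpow h2 hp0.le
          calc (1 : ℝ≥0∞) ≤ 2 ^ (δ * ((lv i : ℝ) - J)) := by
                rw [← ENNReal.rpow_zero (x := 2)]
                refine ENNReal.rpow_le_rpow_of_exponent_le one_le_two (mul_nonneg hδ.le ?_)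
                exact sub_nonneg.2 (by exact_mod_cast hJ)
            _ = 2 ^ s * ((2 : ℝ≥0∞) ^ ((lv i : ℝ) * (t - 1 / p) * p) * (2 ^ x (lv i)) ^ p) := by
                rw [← ENNReal.rpow_mul, ← two_rpow_add, ← two_rpow_add]
                congr 1
                simp only [hx]
                field_simp
                ring
            _ ≤ _ := by gcongr
      _ = 2 ^ s * ∑ i ∈ S, (2 : ℝ≥0∞) ^ ((lv i : ℝ) * (t - 1 / p) * p) * ‖u i‖ₑ ^ p := by
          rw [Finset.mul_sum]
      _ ≤ 2 ^ s * 1 := by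
          gcongr
          exact (ENNReal.sum_le_tsum S).trans (tsum_le_of_mem_mixedBallB hp₁ hp₁t hu)
      _ = 2 ^ s := mul_one _
  · intro u hu
    set D : ℝ≥0∞ := 2 ^ (-(s * (q - p) / p) - J * (q * (t - 1 / p) + 1)) with hD
    calc levelFunctional ε q J (u - fun i => T i (u i))
        ≤ ∑' i, D * ((2 : ℝ≥0∞) ^ ((lv i : ℝ) * (t - 1 / p) * p) * ‖u i‖ₑ ^ p) := by
          refine ENNReal.tsum_le_tsum fun i => ?_
          by_cases hJ : lv i < J
          · simp only [Pi.sub_apply, hTlow i hJ, sub_self, enorm_zero,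
              ENNReal.zero_rpow_of_pos hq0, mul_zero]
            exact zero_le
          have hJ' := not_lt.1 hJ
          obtain ⟨h1, h2, -⟩ := hThigh u hu i hJ'
          have h1' : ‖u i - T i (u i)‖ₑ ≤ ‖u i‖ₑ := enorm_le_iff_norm_le.2 h1
          have h2' : ‖u i - T i (u i)‖ₑ ≤ 2 ^ x (lv i) := (hen _ _).2 h2
          have hqp : 0 ≤ q - p := sub_nonneg.2 hq
          -- Of the `q` factors, `q - p` are bounded by the threshold and `p` by the coefficient,
          -- which leaves an `ℓ_p` sum.
          have h3 : ‖u i - T i (u i)‖ₑ ^ q ≤ 2 ^ (x (lv i) * (q - p)) * ‖u i‖ₑ ^ p := by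
            rw [ENNReal.rpow_mul, ← sub_add_cancel q p, ENNReal.rpow_add_of_nonneg _ _ hqp hp0.le,
              sub_add_cancel]
            gcongr
          refine (mul_le_mul_right h3 _).trans ?_
          rw [← mul_assoc, ← mul_assoc, hD, ← two_rpow_add, ← two_rpow_add]
          refine mul_le_mul_left (ENNReal.rpow_le_rpow_of_exponent_le one_le_two ?_) _
          have hJr : (0 : ℝ) ≤ (lv i : ℝ) - J := sub_nonneg.2 (by exact_mod_cast hJ')
          -- The growth from `ε` and from the rising threshold is compensated by the decay `q * (t -
          -- 1 / p) + 1` per level, so level `J` is the worst one.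
          have h4 := mul_le_mul_of_nonneg_left hα hJr
          have h5 : x (lv i) * (q - p) = -(lv i * (t - 1 / p)) * (q - p) +
              (lv i - J) * (δ * (q - p) / p) - s * (q - p) / p := by
            simp only [hx]
            ring
          change ε * ((lv i : ℝ) - J) - lv i + x (lv i) * (q - p) ≤ _
          rw [h5]
          linarith
      _ ≤ D * 1 := by
          rw [ENNReal.tsum_mul_left]
          gcongr
          exact tsum_le_of_mem_mixedBallB hp₁ hp₁t hu
      _ = D := mul_one _

end Approximation

/-! ### Choice of parameters and the final rate -/

section SparseApproximation

variable {e : ℕ} {A : (Fin (e + 1) → ℕ) → Set (Fin (e + 1) → ℤ)}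

theorem two_rpow_logb_add_one (J : ℕ) :
    (2 : ℝ≥0∞) ^ Real.logb 2 ((J : ℝ) + 1) = (J : ℝ≥0∞) + 1 := by
  rw [← ofReal_two_rpow, Real.rpow_logb two_pos (by norm_num) (by positivity),
    ENNReal.ofReal_add (by positivity) zero_le_one, ENNReal.ofReal_natCast, ENNReal.ofReal_one]

theorem add_one_rpow_eq (J : ℕ) (a : ℝ) :
    ((J : ℝ≥0∞) + 1) ^ a = 2 ^ (Real.logb 2 ((J : ℝ) + 1) * a) := by
  rw [ENNReal.rpow_mul, two_rpow_logb_add_one]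

/-- Truncation at level `J` for the unit ball of `s^t_{∞,∞} b`. -/
theorem levelFunctional_truncation_le {C : ℕ} (hfin : ∀ ν, (A ν).Finite)
    (hcard : ∀ ν, (A ν).ncard ≤ C * 2 ^ (∑ l, ν l)) {t q : ℝ} (hq : 0 < q) (ht : 0 < t) :
    ∃ C' : ℝ≥0∞, C' ≠ ∞ ∧ ∀ (J : ℕ) (v : MixedSeq A), (∀ i, ∑ l, i.1 l < J → v i = 0) →
      (∀ i, ‖v i‖ₑ ≤ 2 ^ (-(((∑ l, i.1 l : ℕ) : ℝ) * t))) →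
      levelFunctional (t * q / 2) q J v ≤ C' * (2 ^ (-(J * t * q)) * ((J : ℝ≥0∞) + 1) ^ e) := by
  have htq : 0 < t * q / 2 := by positivity
  obtain ⟨C₀, hC₀, hsum⟩ := exists_tsum_level_weight_le e htq
  refine ⟨C * C₀, ENNReal.mul_ne_top (ENNReal.natCast_ne_top _) hC₀, fun J v hv0 hv => ?_⟩
  rw [levelFunctional, ENNReal.tsum_sigma']
  -- At most `C * 2 ^ j` coefficients of size `2 ^ (-j * t)` produce decay `t * q` per level; the
  -- weight uses half of it and the other half makes the sum over levels converge.
  have h1 : ∀ ν : Fin (e + 1) → ℕ, ∑' m : A ν,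
      (2 : ℝ≥0∞) ^ (t * q / 2 * (((∑ l, ν l : ℕ) : ℝ) - J) - ((∑ l, ν l : ℕ) : ℝ)) *
        ‖v ⟨ν, m⟩‖ₑ ^ q ≤ C * 2 ^ (-(J * t * q)) * (if J ≤ ∑ l, ν l then
        (2 : ℝ≥0∞) ^ (-(t * q / 2 * (((∑ l, ν l : ℕ) : ℝ) - J))) else 0) := by
    intro ν
    have : Fintype (A ν) := (hfin ν).fintype
    by_cases hJ : J ≤ ∑ l, ν l
    · rw [if_pos hJ, tsum_fintype]
      have h2 : ∀ m : A ν, (2 : ℝ≥0∞) ^ (t * q / 2 * (((∑ l, ν l : ℕ) : ℝ) - J) -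
          ((∑ l, ν l : ℕ) : ℝ)) * ‖v ⟨ν, m⟩‖ₑ ^ q ≤
          2 ^ (t * q / 2 * (((∑ l, ν l : ℕ) : ℝ) - J) - ((∑ l, ν l : ℕ) : ℝ) +
            -(((∑ l, ν l : ℕ) : ℝ) * t) * q) := by
        intro m
        rw [two_rpow_add (_ - _), ENNReal.rpow_mul 2 (-_)]
        gcongr
        exact hv ⟨ν, m⟩
      refine (Finset.sum_le_card_nsmul _ _ _ fun m _ => h2 m).trans ?_
      rw [Finset.card_univ, ← Nat.card_eq_fintype_card, Nat.card_coe_set_eq, nsmul_eq_mul]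
      have h3 : ((A ν).ncard : ℝ≥0∞) ≤ C * 2 ^ (((∑ l, ν l : ℕ) : ℝ)) := by
        rw [ENNReal.rpow_natCast]
        exact_mod_cast hcard ν
      refine (mul_le_mul_left h3 _).trans (le_of_eq ?_)
      rw [mul_assoc, mul_assoc, ← two_rpow_add, ← two_rpow_add]
      congr 2
      ring
    · rw [if_neg hJ, mul_zero, nonpos_iff_eq_zero, ENNReal.tsum_eq_zero]
      intro m
      rw [hv0 ⟨ν, m⟩ (not_le.1 hJ), enorm_zero, ENNReal.zero_rpow_of_pos hq, mul_zero]
  refine (ENNReal.tsum_le_tsum h1).trans ?_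
  rw [ENNReal.tsum_mul_left]
  refine (mul_le_mul_right (hsum J) _).trans (le_of_eq ?_)
  ring

/-- A continuous approximation that is exact below level `J`, keeps few coefficients above
level `J`, and has the optimal error. -/
theorem exists_sparse_approximation {B : ℝ} {C₁ : ℕ}
    (hB : ∀ ν, ∀ m ∈ A ν, dyadicBox ν m ⊆ Icc (fun _ => -B) fun _ => B)
    (hfin : ∀ ν, (A ν).Finite) (hcard : ∀ ν, (A ν).ncard ≤ C₁ * 2 ^ (∑ l, ν l))
    {p₁ : ℝ≥0∞} (hp₁ : 0 < p₁) {p₂ : ℝ} (hp₂ : 0 < p₂) {t : ℝ}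
    (ht : max (p₁⁻¹.toReal - 1 / max p₂ 2) 0 < t) :
    ∃ C : ℝ≥0∞, C ≠ ∞ ∧ ∀ J : ℕ, ∃ (I : Finset (Σ ν, A ν)) (T : (Σ ν, A ν) → ℂ → ℂ),
      (∀ i, Continuous (T i)) ∧ (∀ i ∉ I, ∀ z, T i z = 0) ∧
      (∀ u ∈ mixedBallB A p₁ p₁ t, ∀ S : Finset (Σ ν, A ν),
        (∀ i ∈ S, J ≤ ∑ l, i.1 l ∧ T i (u i) ≠ 0) →
          (S.card : ℝ≥0∞) ≤ 2 ^ J * ((J : ℝ≥0∞) + 1) ^ e * 2⁻¹) ∧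
      (∀ u ∈ mixedBallB A p₁ p₁ t, mixedNormF A p₂ 2 0 (u - fun i => T i (u i)) ≤
        C * (2 ^ (-(J * t)) * ((J : ℝ≥0∞) + 1) ^ ((e : ℝ) * (1 / 2 - p₁⁻¹.toReal)))) ∧
      ∀ u ∈ mixedBallB A p₁ p₁ t, ∀ v ∈ mixedBallB A p₁ p₁ t, (∀ i, T i (u i) = T i (v i)) →
        mixedNormF A p₂ 2 0 (u - v) ≤
          C * (2 ^ (-(J * t)) * ((J : ℝ≥0∞) + 1) ^ ((e : ℝ) * (1 / 2 - p₁⁻¹.toReal))) := by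
  have ht0 : 0 < t := (le_max_right _ _).trans_lt ht
  have ht1 : p₁⁻¹.toReal - 1 / max p₂ 2 < t := (le_max_left _ _).trans_lt ht
  by_cases hp₁t : p₁ = ∞
  · subst hp₁t
    set q := max p₂ 2
    have hq2 : 2 ≤ q := le_max_right _ _
    have hp₂q : p₂ ≤ q := le_max_left _ _
    have hq0 : 0 < q := two_pos.trans_le hq2
    obtain ⟨C, hC, hmain⟩ := exists_error_le (A := A) hB hp₂ hp₂q hq2
      (ε := t * q / 2) (by positivity)
    obtain ⟨C', hC', htr⟩ := levelFunctional_truncation_le hfin hcard hq0 ht0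
    refine ⟨C * C' ^ (1 / q), ENNReal.mul_ne_top hC
      (ENNReal.rpow_ne_top_of_nonneg (by positivity) hC'), fun J => ?_⟩
    classical
    set T : (Σ ν, A ν) → ℂ → ℂ := fun i => if ∑ l, i.1 l < J then id else fun _ => 0 with hT
    have hlow : ∀ i, ∑ l, i.1 l < J → ∀ z, T i z = z := fun i hi z => by simp [hT, hi]
    have hhigh : ∀ i, ¬ ∑ l, i.1 l < J → ∀ z, T i z = 0 := fun i hi z => by
      simp only [hT, if_neg hi]
    have herr := hmain J (mixedBallB A ∞ ∞ t) T _ hlow fun u hu => htr J _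
      (fun i hi => by simp [hlow i hi]) fun i => by
        have h1 := enorm_le_of_mem_mixedBallB hp₁ hu i
        simp only [ENNReal.inv_top, ENNReal.toReal_zero, sub_zero] at h1
        by_cases hi : ∑ l, i.1 l < J
        · simp [hlow i hi]
        · simpa [hhigh i hi] using h1
    have heq : C * (((J : ℝ≥0∞) + 1) ^ ((e : ℝ) * (1 / 2 - 1 / q)) *
        (C' * (2 ^ (-(J * t * q)) * ((J : ℝ≥0∞) + 1) ^ e)) ^ (1 / q)) =
        C * C' ^ (1 / q) * (2 ^ (-(J * t)) *
          ((J : ℝ≥0∞) + 1) ^ ((e : ℝ) * (1 / 2 - (∞ : ℝ≥0∞)⁻¹.toReal))) := by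
      have hq' : 0 ≤ 1 / q := by positivity
      rw [ENNReal.inv_top, ENNReal.toReal_zero, ENNReal.mul_rpow_of_nonneg _ _ hq',
        ENNReal.mul_rpow_of_nonneg _ _ hq', ← ENNReal.rpow_natCast _ e, add_one_rpow_eq,
        add_one_rpow_eq, add_one_rpow_eq, ← ENNReal.rpow_mul, ← ENNReal.rpow_mul, ← two_rpow_add,
        ← two_rpow_add]
      have hx : -((J : ℝ) * t) + Real.logb 2 ((J : ℝ) + 1) * (e * (1 / 2 - 0)) =
          Real.logb 2 ((J : ℝ) + 1) * (e * (1 / 2 - 1 / q)) +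
            (-(J * t * q) * (1 / q) + Real.logb 2 ((J : ℝ) + 1) * e * (1 / q)) := by
        field_simp
        ring
      rw [hx, two_rpow_add (Real.logb 2 ((J : ℝ) + 1) * (e * (1 / 2 - 1 / q)))]
      ring
    rw [heq] at herr
    refine ⟨(finite_level_lt hfin J).toFinset, T, ?_, ?_, ?_, herr.1, herr.2⟩
    · intro i
      simp only [hT]
      split_ifs
      · exact continuous_id
      · exact continuous_const
    · exact fun i hi z => hhigh i (by simpa using hi) z
    · intro u _ S hS
      have : S = ∅ := Finset.eq_empty_of_forall_notMem fun i hi =>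
        (hS i hi).2 (hhigh i (not_lt.2 (hS i hi).1) _)
      rw [this, Finset.card_empty, Nat.cast_zero]
      exact zero_le
  · have hinv : p₁⁻¹.toReal = 1 / p₁.toReal := by rw [ENNReal.toReal_inv, one_div]
    rw [hinv] at ht1 ⊢
    set p := p₁.toReal with hp
    have hp0 : 0 < p := ENNReal.toReal_pos hp₁.ne' hp₁t
    -- `q` must dominate `p₂` and `2` for the square function estimate and `p` for thresholding.
    set q := max (max p₂ 2) p with hq
    have hpq : p ≤ q := le_max_right _ _
    have hq2 : 2 ≤ q := (le_max_right _ _).trans (le_max_left _ _)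
    have hp₂q : p₂ ≤ q := (le_max_left _ _).trans (le_max_left _ _)
    have hq0 : 0 < q := two_pos.trans_le hq2
    -- This is `t > 1 / p - 1 / q`: the smoothness assumption if `q = max p₂ 2`, and `t > 0` if `q =
    -- p`.
    have hα : 0 < q * (t - 1 / p) + 1 := by
      have h1 : 1 / p - 1 / q < t := by
        rcases max_choice (max p₂ 2) p with h | h
        · rwa [hq, h]
        · rwa [hq, h, sub_self]
      have h2 : 0 < q * (t - (1 / p - 1 / q)) := mul_pos hq0 (sub_pos.2 h1)
      have h3 : q * (1 / q) = 1 := mul_one_div_cancel hq0.ne'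
      linarith
    set α := q * (t - 1 / p) + 1 with hαdef
    obtain ⟨C, hC, hmain⟩ := exists_error_le (A := A) hB hp₂ hp₂q hq2 (half_pos hα)
    refine ⟨C * 2 ^ (1 / p - 1 / q), ENNReal.mul_ne_top hC (two_rpow_ne_top _), fun J => ?_⟩
    set L := Real.logb 2 ((J : ℝ) + 1) with hL
    have hδ : 0 < α * p / (2 * q) := by positivity
    -- With `ε = α / 2` and this `δ` the total growth per level is `α - α * p / (2 * q)`, below `α`.
    -- The choice of `s` makes `2 ^ s` half of `2 ^ J * (J + 1) ^ e`; the half forces no survivors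
    -- at all when `J = 0`.
    obtain ⟨I, T, hTc, hTI, hlow, hcount, herr⟩ := exists_threshold_approximation hfin hp₁ hp₁t
      hpq hδ (ε := α / 2) (t := t) (by
        have : α * p / (2 * q) * (q - p) / p = α / 2 - α * p / (2 * q) := by
          field_simp
        rw [← hp, this, ← hαdef]
        linarith) J (J + L * e - 1)
    refine ⟨I, T, hTc, hTI, fun u hu S hS => (hcount u hu S hS).trans (le_of_eq ?_), ?_⟩
    · rw [sub_eq_add_neg, two_rpow_add, two_rpow_add, hL, ← add_one_rpow_eq, ENNReal.rpow_natCast,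
        ENNReal.rpow_natCast, ENNReal.rpow_neg_one]
    · have h := hmain J _ T _ hlow herr
      have heq : C * (((J : ℝ≥0∞) + 1) ^ ((e : ℝ) * (1 / 2 - 1 / q)) *
          ((2 : ℝ≥0∞) ^ (-((J + L * e - 1) * (q - p) / p) - J * α)) ^ (1 / q)) =
          C * 2 ^ (1 / p - 1 / q) * (2 ^ (-(J * t)) *
            ((J : ℝ≥0∞) + 1) ^ ((e : ℝ) * (1 / 2 - 1 / p))) := by
        rw [add_one_rpow_eq, add_one_rpow_eq, ← ENNReal.rpow_mul, mul_assoc, ← two_rpow_add,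
          ← two_rpow_add, ← two_rpow_add, ← hL, hαdef]
        congr 2
        field_simp
        ring
      rw [heq] at h
      exact h

/-- The cut-off level that belongs to the budget `n`. -/
theorem exists_level (e c n : ℕ) (hc : 1 ≤ c) : ∃ J : ℕ,
    (J = 0 ∨ c * (2 ^ J * (J + 1) ^ e) ≤ n) ∧ n ≤ c * 2 ^ (e + 1) * (2 ^ J * (J + 1) ^ e) := by
  set P : ℕ → Prop := fun J => c * (2 ^ J * (J + 1) ^ e) ≤ n with hP
  have hlarge : ¬ P n := by
    have h1 : n < 2 ^ n := Nat.lt_two_pow_self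
    have h2 : 1 ≤ (n + 1) ^ e := Nat.one_le_pow _ _ (Nat.succ_pos n)
    simp only [hP, not_le]
    calc n < 1 * (2 ^ n * 1) := by omega
      _ ≤ c * (2 ^ n * (n + 1) ^ e) := by gcongr
  classical
  have hex : ∃ J, ¬ P J := ⟨n, hlarge⟩
  have hbound : ∀ J, ¬ P (J + 1) → n ≤ c * 2 ^ (e + 1) * (2 ^ J * (J + 1) ^ e) := by
    intro J hJ
    refine (not_le.1 hJ).le.trans ?_
    calc c * (2 ^ (J + 1) * (J + 1 + 1) ^ e) ≤ c * (2 ^ (J + 1) * (2 * (J + 1)) ^ e) := by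
          gcongr
          omega
      _ = c * 2 ^ (e + 1) * (2 ^ J * (J + 1) ^ e) := by
          rw [mul_pow]
          ring
  rcases Nat.eq_zero_or_pos (Nat.find hex) with h | h
  · have h0 : ¬ P 0 := h ▸ Nat.find_spec hex
    refine ⟨0, Or.inl rfl, hbound 0 fun h1 => h0 (le_trans ?_ h1)⟩
    gcongr <;> omega
  · obtain ⟨J, hJ⟩ := Nat.exists_eq_succ_of_ne_zero h.ne'
    refine ⟨J, Or.inr ?_, hbound J ?_⟩
    · exact not_not.1 (Nat.find_min hex (m := J) (by omega))
    · have := Nat.find_spec hex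
      rwa [hJ] at this

/-- With `g = 2 ^ J * (J + 1) ^ e` the left side equals `g ^ (-t) * (J + 1) ^ (e * (t - r + 1 /
2))`. Here `g` is at least a constant times `n`, and `J + 1` is at most a constant times `log n`;
the signs of the exponents make these one-sided bounds sufficient. -/
theorem rate_le {e c n J : ℕ} (hc : 1 ≤ c) (hn : 2 ≤ n)
    (h₁ : J = 0 ∨ c * (2 ^ J * (J + 1) ^ e) ≤ n)
    (h₂ : n ≤ c * 2 ^ (e + 1) * (2 ^ J * (J + 1) ^ e)) {t r : ℝ} (ht : 0 < t)
    (hs : 0 < t - r + 1 / 2) :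
    (2 : ℝ) ^ (-(J * t)) * ((J : ℝ) + 1) ^ ((e : ℝ) * (1 / 2 - r)) ≤
      ((c * 2 ^ (e + 1) : ℕ) : ℝ) ^ t * (2 / Real.log 2) ^ ((e : ℝ) * (t - r + 1 / 2)) *
        ((n : ℝ) ^ (-t) * Real.log n ^ ((e : ℝ) * (t - r + 1 / 2))) := by
  have hl2 : 0 < Real.log 2 := Real.log_pos one_lt_two
  have hn2 : (2 : ℝ) ≤ n := by exact_mod_cast hn
  have hn0 : (0 : ℝ) < n := by linarith
  have hln : Real.log 2 ≤ Real.log n := Real.log_le_log two_pos hn2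
  have hJ1 : (0 : ℝ) < (J : ℝ) + 1 := by positivity
  set g : ℝ := 2 ^ J * ((J : ℝ) + 1) ^ e with hg
  have hg0 : 0 < g := by positivity
  have hng : (n : ℝ) ≤ ((c * 2 ^ (e + 1) : ℕ) : ℝ) * g := by
    rw [hg]
    exact_mod_cast h₂
  have hM0 : (0 : ℝ) < ((c * 2 ^ (e + 1) : ℕ) : ℝ) := by
    have : 0 < c * 2 ^ (e + 1) := by positivity
    exact_mod_cast this
  have hlog : (J : ℝ) + 1 ≤ 2 / Real.log 2 * Real.log n := by
    rw [div_mul_eq_mul_div, le_div_iff₀ hl2]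
    rcases h₁ with rfl | h₁
    · norm_num
      linarith
    · have h3 : 2 ^ J ≤ n := by
        refine le_trans ?_ h₁
        have : 1 ≤ (J + 1) ^ e := Nat.one_le_pow _ _ (Nat.succ_pos J)
        calc 2 ^ J = 1 * (2 ^ J * 1) := by ring
          _ ≤ c * (2 ^ J * (J + 1) ^ e) := by gcongr
      have h4 : (J : ℝ) * Real.log 2 ≤ Real.log n := by
        rw [← Real.log_pow]
        exact Real.log_le_log (by positivity) (by exact_mod_cast h3)
      linarith
  have heq : (2 : ℝ) ^ (-(J * t)) * ((J : ℝ) + 1) ^ ((e : ℝ) * (1 / 2 - r)) =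
      g ^ (-t) * ((J : ℝ) + 1) ^ ((e : ℝ) * (t - r + 1 / 2)) := by
    rw [hg, Real.mul_rpow (by positivity) (by positivity), ← Real.rpow_natCast, ← Real.rpow_natCast,
      ← Real.rpow_mul two_pos.le, ← Real.rpow_mul hJ1.le, mul_assoc, ← Real.rpow_add hJ1]
    congr 2 <;> ring
  have hgt : g ^ (-t) ≤ ((c * 2 ^ (e + 1) : ℕ) : ℝ) ^ t * (n : ℝ) ^ (-t) := by
    rw [Real.rpow_neg hg0.le, Real.rpow_neg hn0.le, ← div_eq_mul_inv, le_div_iff₀ (by positivity),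
      inv_mul_le_iff₀ (by positivity), mul_comm, ← Real.mul_rpow hM0.le hg0.le]
    exact Real.rpow_le_rpow hn0.le hng ht.le
  have hJs : ((J : ℝ) + 1) ^ ((e : ℝ) * (t - r + 1 / 2)) ≤
      (2 / Real.log 2) ^ ((e : ℝ) * (t - r + 1 / 2)) *
        Real.log n ^ ((e : ℝ) * (t - r + 1 / 2)) := by
    rw [← Real.mul_rpow (by positivity) (by linarith)]
    exact Real.rpow_le_rpow hJ1.le hlog (by positivity)
  rw [heq]
  refine (mul_le_mul hgt hJs (by positivity) (by positivity)).trans (le_of_eq ?_)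
  ring

end SparseApproximation

theorem theorem6 (d : ℕ) (hd : 1 ≤ d) (N : ℕ) (hN : 1 ≤ N) (ψ₀ ψ₁ : ℝ → ℂ)
    (hψ : IsWaveletSystem N ψ₀ ψ₁) (p₁ : ℝ≥0∞) (hp₁ : 0 < p₁) (p₂ : ℝ) (hp₂ : 0 < p₂) (t : ℝ)
    (ht : max (p₁⁻¹.toReal - 1 / max p₂ 2) 0 < t) :
    ∃ c : ℝ, 0 < c ∧ ∀ n : ℕ, 2 ≤ n →
      alexandroffWidth (mixedNormF (cubeIndex (d := d) ψ₀ ψ₁) p₂ 2 0)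
          (mixedBallB (cubeIndex (d := d) ψ₀ ψ₁) p₁ p₁ t) n ≤
        ENNReal.ofReal (c * ((n : ℝ) ^ (-t) *
          Real.log n ^ (((d : ℝ) - 1) * (t - p₁⁻¹.toReal + 1 / 2)))) ∧
      coWidth (mixedNormF (cubeIndex (d := d) ψ₀ ψ₁) p₂ 2 0)
          (mixedBallB (cubeIndex (d := d) ψ₀ ψ₁) p₁ p₁ t) n ≤
        ENNReal.ofReal (c * ((n : ℝ) ^ (-t) *
          Real.log n ^ (((d : ℝ) - 1) * (t - p₁⁻¹.toReal + 1 / 2)))) ∧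
      manifoldWidth (mixedNormF (cubeIndex (d := d) ψ₀ ψ₁) p₂ 2 0)
          (mixedBallB (cubeIndex (d := d) ψ₀ ψ₁) p₁ p₁ t) n ≤
        ENNReal.ofReal (c * ((n : ℝ) ^ (-t) *
          Real.log n ^ (((d : ℝ) - 1) * (t - p₁⁻¹.toReal + 1 / 2)))) := by
  obtain ⟨e, rfl⟩ : ∃ e, d = e + 1 := ⟨d - 1, by omega⟩
  have hinf := hψ.infinite_cubeIndex hd
  obtain ⟨C₁, hC₁⟩ := exists_cubeIndex_ncard_le hψ.compact_zero hψ.compact_one (e + 1)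
  obtain ⟨B, hB⟩ := exists_dyadicBox_subset hψ.compact_zero hψ.compact_one (e + 1)
  have hfin := fun ν => (hC₁ ν).1
  have hcard := fun ν => (hC₁ ν).2
  obtain ⟨C, hC, happ⟩ := exists_sparse_approximation hB hfin hcard hp₁ hp₂ ht
  have ht0 : 0 < t := (le_max_right _ _).trans_lt ht
  have hs : 0 < t - p₁⁻¹.toReal + 1 / 2 := by
    have h1 := (le_max_left _ _).trans_lt ht
    have h2 : 1 / max p₂ 2 ≤ 1 / 2 := one_div_le_one_div_of_le two_pos (le_max_right _ _)
    linarith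
  -- The factor `4` is the sparsity demanded by `widths_le`; `C₁` counts the indices below level `J`
  -- and `1` the survivors above.
  set M : ℕ := 4 * (C₁ + 1) with hM
  have hM1 : 1 ≤ M := by omega
  have hl2 : 0 < Real.log 2 := Real.log_pos one_lt_two
  set c₀ : ℝ := ((M * 2 ^ (e + 1) : ℕ) : ℝ) ^ t *
    (2 / Real.log 2) ^ ((e : ℝ) * (t - p₁⁻¹.toReal + 1 / 2)) with hc₀
  have hc₀0 : 0 ≤ c₀ := by positivity
  refine ⟨C.toReal * c₀ + 1, by positivity, fun n hn => ?_⟩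
  obtain ⟨J, hJ₁, hJ₂⟩ := exists_level e M n hM1
  obtain ⟨I, T, hTc, hTI, hcount, herr₁, herr₂⟩ := happ J
  have hln : 0 < Real.log n := Real.log_pos (by exact_mod_cast hn)
  have hrate : C * (2 ^ (-(J * t)) * ((J : ℝ≥0∞) + 1) ^ ((e : ℝ) * (1 / 2 - p₁⁻¹.toReal))) ≤
      ENNReal.ofReal ((C.toReal * c₀ + 1) * ((n : ℝ) ^ (-t) *
        Real.log n ^ ((((e + 1 : ℕ) : ℝ) - 1) * (t - p₁⁻¹.toReal + 1 / 2)))) := by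
    have h1 := rate_le (r := p₁⁻¹.toReal) hM1 hn hJ₁ hJ₂ ht0 hs
    have h2 : C * (2 ^ (-(J * t)) * ((J : ℝ≥0∞) + 1) ^ ((e : ℝ) * (1 / 2 - p₁⁻¹.toReal))) =
        ENNReal.ofReal (C.toReal * ((2 : ℝ) ^ (-(J * t)) *
          ((J : ℝ) + 1) ^ ((e : ℝ) * (1 / 2 - p₁⁻¹.toReal)))) := by
      rw [ENNReal.ofReal_mul ENNReal.toReal_nonneg, ENNReal.ofReal_toReal hC,
        ENNReal.ofReal_mul (by positivity), ofReal_two_rpow,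
        ← ENNReal.ofReal_rpow_of_pos (by positivity), ENNReal.ofReal_add (by positivity) zero_le_one,
        ENNReal.ofReal_natCast, ENNReal.ofReal_one]
    rw [h2, Nat.cast_succ, add_sub_cancel_right]
    refine ENNReal.ofReal_le_ofReal ?_
    refine (mul_le_mul_of_nonneg_left h1 ENNReal.toReal_nonneg).trans ?_
    rw [← mul_assoc]
    refine mul_le_mul_of_nonneg_right ?_ (by positivity)
    linarith
  classical
  refine widths_le (mixedNormF_le_of_finite hB hp₂) (enorm_le_mixedNormF hp₂) ?_ hTc hTI ?_
    (fun u hu => (herr₁ u hu).trans hrate) (fun u hu v hv huv => (herr₂ u hu v hv huv).trans hrate)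
  · intro i
    refine ⟨(2 : ℝ) ^ (-(((∑ l, i.1 l : ℕ) : ℝ) * (t - p₁⁻¹.toReal))), fun u hu => ?_⟩
    have h1 := enorm_le_of_mem_mixedBallB hp₁ hu i
    rwa [← ofReal_two_rpow, ← ofReal_norm,
      ENNReal.ofReal_le_ofReal_iff (Real.rpow_pos_of_pos two_pos _).le] at h1
  · intro u hu
    set S := I.filter fun i => T i (u i) ≠ 0 with hS
    have h1 := hcount u hu (S.filter fun i => ¬ ∑ l, i.1 l < J) fun i hi =>
      ⟨not_lt.1 (Finset.mem_filter.1 hi).2, (Finset.mem_filter.1 (Finset.mem_filter.1 hi).1).2⟩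
    have h2 := card_le_of_level_lt hfin hcard J (S.filter fun i => ∑ l, i.1 l < J) fun i hi =>
      (Finset.mem_filter.1 hi).2
    have h3 := Finset.card_filter_add_card_filter_not (s := S) fun i => ∑ l, i.1 l < J
    -- For `J = 0` nothing lies below the cut-off, and a cardinality bounded by `1 / 2` vanishes, so
    -- the approximation is zero and fits any budget.
    rcases hJ₁ with rfl | hJ₁
    · have h4 : (S.filter fun i => ∑ l, i.1 l < 0) = ∅ := by simp
      have h5 : (S.filter fun i => ¬ ∑ l, i.1 l < 0).card = 0 := by
        by_contra h
        have h6 : (1 : ℝ≥0∞) ≤ (S.filter fun i => ¬ ∑ l, i.1 l < 0).card := by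
          exact_mod_cast Nat.one_le_iff_ne_zero.2 h
        have h7 := h6.trans h1
        simp only [pow_zero, Nat.cast_zero, zero_add, one_pow, one_mul,
          ENNReal.one_le_inv] at h7
        exact absurd h7 (by norm_num)
      rw [h4, Finset.card_empty] at h3
      omega
    · have h4 : (S.filter fun i => ¬ ∑ l, i.1 l < J).card ≤ 2 ^ J * (J + 1) ^ e := by
        have : ((S.filter fun i => ¬ ∑ l, i.1 l < J).card : ℝ≥0∞) ≤ 2 ^ J * ((J : ℝ≥0∞) + 1) ^ e :=
          h1.trans (mul_le_of_le_one_right' (ENNReal.inv_le_one.2 one_le_two))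
        exact_mod_cast this
      have h5 : (S.filter fun i => ∑ l, i.1 l < J).card ≤ C₁ * (2 ^ J * (J + 1) ^ e) := by
        exact_mod_cast h2
      calc 4 * S.card ≤ 4 * (C₁ * (2 ^ J * (J + 1) ^ e) + 2 ^ J * (J + 1) ^ e) := by omega
        _ = M * (2 ^ J * (J + 1) ^ e) := by rw [hM]; ring
        _ ≤ n := hJ₁
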